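/- Let $H$ be a complex Hilbert space and let $E,A\in L(H)$ be bounded linear operators. Put $\rho(E,A)=\{s\in\mathbb{C} : (sE+A)^{-1}\in L(H)\}$ and $\mathbb{C}_{\Re>\mu}=\{s\in\mathbb{C}:\Re s>\mu\}$. Assume that $(E,A)$ is regular, i.e. there are $\nu_0\in\mathbb{R}$, $C_0\ge 0$, $j\in\mathbb{N}=\{0,1,2,\dots\}$ with $\mathbb{C}_{\Re>\nu_0}\subseteq\rho(E,A)$ and $\|(sE+A)^{-1}\|\le C_0|s|^{j}$ for all $s\in\mathbb{C}_{\Re>\nu_0}$; fix such a $\nu_0$ and let $k=\mathrm{ind}(E,A)$ be the smallest $j\in\mathbb{N}$ for which such an estimate holds on $\mathbb{C}_{\Re>\nu_0}$ with some $C_0\geq 0$. For $\nu\in\mathbb{R}$ let $L_{2,\nu}(\mathbb{R};H)$ be the space of (equivalence classes of) measurable $f:\mathbb{R}\to H$ with $\int_{\mathbb{R}}|f(t)|_H^2e^{-2\nu t}\,dt<\infty$, and let $\partial_{0,\nu}$ be the weak derivative in $L_{2,\nu}(\mathbb{R};H)$, with domain $H^1_\nu(\mathbb{R};H)$, the set of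 all $f\in L_{2,\nu}(\mathbb{R};H)$ whose weak derivative belongs to $L_{2,\nu}(\mathbb{R};H)$. The operators $E$ and $A$ act pointwise on $L_{2,\nu}(\mathbb{R};H)$, and sums, products, powers and inverses of operators carry their natural domains; thus $\partial_{0,\nu}E+A$ has domain $\{u\in L_{2,\nu}(\mathbb{R};H): Eu\in H^1_\nu(\mathbb{R};H)\}$. Let $\nu>0$ be such that $\mathbb{C}_{\Re>\nu}\subseteq\rho(E,A)$ and, for some $C\ge0$, $\|(sE+A)^{-1}\|\le C|s|^{k}$ for all $s\in\mathbb{C}_{\Re>\nu}$. Then $\partial_{0,\nu}:H^1_\nu(\mathbb{R};H)\to L_{2,\nu}(\mathbb{R};H)$ is bijective, $\partial_{0,\nu}E+A$ is injective, and the operator $$\partial_{0,\nu}^{-k}\left(\partial_{0,\nu}E+A\right)^{-1}$$ is densely defined in $L_{2,\nu}(\mathbb{R};H)$ and extends (uniquely) to a bounded linear operator $S\in L(L_{2,\nu}(\mathbb{R};H))$. Moreover $S$ is causal: for all $a\in\mathbb{R}$ and all $f\in L_{2,\nu}(\mathbb{R};H)$ with $\operatorname{spt} f\subseteq[a,\infty)$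 we have $\operatorname{spt} Sf\subseteq[a,\infty)$. Here $\operatorname{spt} f$ is the complement of the largest open set on which $f=0$ almost everywhere. -/

import Mathlib

open MeasureTheory Set Filter Topology
open scoped ContDiff ENNReal

noncomputable section

namespace DAE

section Pencil

variable {H : Type*} [NormedAddCommGroup H] [InnerProductSpace ℂ H]

/-- The set `ρ(E, A)` of all `s` for which `sE + A` has an inverse in `L(H)`. -/
def resolventSet (E A : H →L[ℂ] H) : Set ℂ :=
  {s | IsUnit (s • E + A)}

/-- The inverse `(sE + A)⁻¹` in `L(H)`, for `s ∈ ρ(E, A)` (it is `0` for other `s`). -/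
def resolvent (E A : H →L[ℂ] H) (s : ℂ) : H →L[ℂ] H :=
  Ring.inverse (s • E + A)

/-- The estimate `‖(sE + A)⁻¹‖ ≤ C |s|^k` on the half-plane `Re s > ν`. -/
def ResolventBound (E A : H →L[ℂ] H) (ν C : ℝ) (k : ℕ) : Prop :=
  ∀ s : ℂ, ν < s.re → ‖resolvent E A s‖ ≤ C * ‖s‖ ^ k

/-- `(E, A)` is regular, as witnessed by the half-plane `Re s > ν`. -/
structure IsRegularOn (E A : H →L[ℂ] H) (ν : ℝ) : Prop where
  subset_resolventSet : {s : ℂ | ν < s.re} ⊆ resolventSet E A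
  exists_bound : ∃ C : ℝ, 0 ≤ C ∧ ∃ k : ℕ, ResolventBound E A ν C k

/-- The index of `(E, A)`: the smallest `k` occurring in a resolvent estimate on the half-plane
`Re s > ν` that witnesses regularity. -/
def index (E A : H →L[ℂ] H) (ν : ℝ) : ℕ :=
  sInf {k : ℕ | ∃ C : ℝ, 0 ≤ C ∧ ResolventBound E A ν C k}

end Pencil

section UnboundedOperators

variable {X Y Z : Type*} [AddCommGroup X] [Module ℂ X] [AddCommGroup Y] [Module ℂ Y]
  [AddCommGroup Z] [Module ℂ Z]

/-- The composition `g f` of partially defined operators with its natural domain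
`{x ∈ D(f) | f x ∈ D(g)}`. -/
def opComp (g : Y →ₗ.[ℂ] Z) (f : X →ₗ.[ℂ] Y) : X →ₗ.[ℂ] Z :=
  g.comp (f.domRestrict ((g.domain.comap f.toFun).map f.domain.subtype)) (by
    rintro ⟨x, hx⟩
    obtain ⟨⟨y, hy, hyx⟩, hx'⟩ := id hx
    have : (f.domRestrict ((g.domain.comap f.toFun).map f.domain.subtype)) ⟨x, hx⟩ = f y :=
      LinearPMap.domRestrict_apply (by exact hyx.symm)
    rw [this]
    exact hy)

theorem mem_graph_opComp (g : Y →ₗ.[ℂ] Z) (f : X →ₗ.[ℂ] Y) (x : X) (z : Z) :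
    (x, z) ∈ (opComp g f).graph ↔ ∃ y, (x, y) ∈ f.graph ∧ (y, z) ∈ g.graph := by
  constructor
  · intro h
    obtain ⟨⟨w, hw⟩, hwx, hwz⟩ := (LinearPMap.mem_graph_iff _).1 h
    obtain ⟨⟨y, hy, hyx⟩, hx'⟩ := id hw
    have hyw : (f.domRestrict ((g.domain.comap f.toFun).map f.domain.subtype)) ⟨w, hw⟩ = f y :=
      LinearPMap.domRestrict_apply (by exact hyx.symm)
    have hyw' : (y : X) = w := hyx
    refine ⟨f y, (LinearPMap.mem_graph_iff _).2 ⟨y, hyw'.trans hwx, rfl⟩,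
      (LinearPMap.mem_graph_iff _).2 ⟨⟨f y, hy⟩, rfl, ?_⟩⟩
    rw [← hwz]
    change g _ = g _
    congr 1
    exact Subtype.ext hyw.symm
  · rintro ⟨y, hxy, hyz⟩
    obtain ⟨a, ha, hay⟩ := (LinearPMap.mem_graph_iff _).1 hxy
    obtain ⟨b, hb, hbz⟩ := (LinearPMap.mem_graph_iff _).1 hyz
    simp only at ha hay hb hbz
    have hmem : f a ∈ g.domain := by rw [hay, ← hb]; exact b.2
    have hw : (a : X) ∈ (f.domRestrict
        ((g.domain.comap f.toFun).map f.domain.subtype)).domain := ⟨⟨a, hmem, rfl⟩, a.2⟩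
    refine (LinearPMap.mem_graph_iff _).2 ⟨⟨a, hw⟩, ha, ?_⟩
    have hyw : (f.domRestrict ((g.domain.comap f.toFun).map f.domain.subtype)) ⟨a, hw⟩ = f a :=
      LinearPMap.domRestrict_apply rfl
    change g _ = z
    rw [← hbz]
    congr 1
    exact Subtype.ext (hyw.trans (hay.trans hb.symm))

/-- The powers `f ^ k` of a partially defined operator, with their natural domains. -/
def opPow (f : X →ₗ.[ℂ] X) : ℕ → (X →ₗ.[ℂ] X)
  | 0 => (LinearMap.id : X →ₗ[ℂ] X).toPMap ⊤
  | k + 1 => opComp f (opPow f k)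

end UnboundedOperators

/-- The measure `exp(-2νt) dt` on `ℝ`. -/
def expMeasure (ν : ℝ) : Measure ℝ :=
  volume.withDensity fun t => ENNReal.ofReal (Real.exp (-2 * ν * t))

section WeightedL2

variable (H : Type*) [NormedAddCommGroup H] [InnerProductSpace ℂ H]

/-- The space `L_{2,ν}(ℝ; H)`. -/
abbrev WeightedL2 (ν : ℝ) : Type _ := Lp H 2 (expMeasure ν)

variable {H}

/-- The (essential) support of a function on `ℝ`: the complement of the largest open set on
which `f` vanishes almost everywhere. -/
def essSupp (f : ℝ → H) : Set ℝ :=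
  {t | ∀ U ∈ 𝓝 t, ¬ (∀ᵐ x ∂(volume.restrict U), f x = 0)}

/-- `g` is the weak derivative of `f` on `ℝ`. -/
def IsWeakDeriv (f g : ℝ → H) : Prop :=
  ∀ φ : ℝ → ℝ, ContDiff ℝ ∞ φ → HasCompactSupport φ →
    ∫ t, deriv φ t • f t = -∫ t, φ t • g t

theorem volume_ac_expMeasure (ν : ℝ) : (volume : Measure ℝ) ≪ expMeasure ν := by
  refine withDensity_absolutelyContinuous' (by fun_prop) ?_
  filter_upwards with t
  simp [Real.exp_pos]

theorem locallyIntegrable {ν : ℝ} (f : WeightedL2 H ν) :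
    LocallyIntegrable (f : ℝ → H) volume := by
  have hm : AEStronglyMeasurable (f : ℝ → H) volume :=
    (Lp.aestronglyMeasurable f).mono_ac (volume_ac_expMeasure ν)
  have h2 : Integrable (fun t => ‖f t‖ ^ 2)
      (volume.withDensity fun t => ENNReal.ofReal (Real.exp (-2 * ν * t))) :=
    (memLp_two_iff_integrable_sq_norm (Lp.aestronglyMeasurable f)).1 (Lp.memLp f)
  rw [integrable_withDensity_iff_integrable_smul' (by fun_prop) (by simp)] at h2
  have h3 : MemLp (fun t => Real.exp (-ν * t) • f t) 2 (volume : Measure ℝ) := by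
    have hm' : AEStronglyMeasurable (fun t => Real.exp (-ν * t) • f t) volume :=
      (by fun_prop : Continuous fun t : ℝ => Real.exp (-ν * t)).aestronglyMeasurable.smul hm
    refine (memLp_two_iff_integrable_sq_norm hm').2 ?_
    refine h2.congr ?_
    filter_upwards with t
    rw [ENNReal.toReal_ofReal (Real.exp_pos _).le, norm_smul, mul_pow, Real.norm_eq_abs, sq_abs,
      ← Real.exp_nat_mul, smul_eq_mul]
    congr 2
    push_cast
    ring
  have h5 : LocallyIntegrable
      (fun t => Real.exp (ν * t) • (Real.exp (-ν * t) • f t)) volume := by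
    rw [← locallyIntegrableOn_univ]
    exact ((locallyIntegrableOn_univ.2 (h3.locallyIntegrable (by norm_num))).continuousOn_smul
      isOpen_univ.isLocallyClosed
      (by fun_prop : Continuous fun t : ℝ => Real.exp (ν * t)).continuousOn)
  refine h5.congr ?_
  filter_upwards with t
  rw [smul_smul, ← Real.exp_add]
  simp

theorem integrable_smul {ν : ℝ} (f : WeightedL2 H ν) {ψ : ℝ → ℝ} (hψ : Continuous ψ)
    (hc : HasCompactSupport ψ) : Integrable (fun t => ψ t • f t) (volume : Measure ℝ) :=
  (locallyIntegrable f).integrable_smul_left_of_hasCompactSupport hψ hc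

variable (H) in
/-- The graph of the weak derivative on `L_{2,ν}(ℝ; H)`. -/
def weakDerivGraph (ν : ℝ) : Submodule ℂ (WeightedL2 H ν × WeightedL2 H ν) where
  carrier := {p | IsWeakDeriv (p.1 : ℝ → H) (p.2 : ℝ → H)}
  zero_mem' := by
    intro φ _ _
    have h0 : ∀ᵐ t ∂(volume : Measure ℝ), ((0 : WeightedL2 H ν) : ℝ → H) t = 0 :=
      (volume_ac_expMeasure ν).ae_le (Lp.coeFn_zero H 2 (expMeasure ν))
    have h1 : ∀ ψ : ℝ → ℝ, ∫ t, ψ t • ((0 : WeightedL2 H ν) : ℝ → H) t = 0 := by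
      intro ψ
      refine integral_eq_zero_of_ae ?_
      filter_upwards [h0] with t ht
      change ψ t • _ = (0 : H)
      rw [ht, smul_zero]
    change ∫ t, deriv φ t • ((0 : WeightedL2 H ν) : ℝ → H) t
      = -∫ t, φ t • ((0 : WeightedL2 H ν) : ℝ → H) t
    rw [h1, h1, neg_zero]
  add_mem' := by
    intro p q hp hq φ hφ hc
    have key : ∀ (f g : WeightedL2 H ν) (ψ : ℝ → ℝ), Continuous ψ → HasCompactSupport ψ →
        ∫ t, ψ t • ((f + g : WeightedL2 H ν) : ℝ → H) t
          = (∫ t, ψ t • f t) + ∫ t, ψ t • g t := by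
      intro f g ψ hψ hψc
      rw [← integral_add (integrable_smul f hψ hψc) (integrable_smul g hψ hψc)]
      refine integral_congr_ae ?_
      filter_upwards [(volume_ac_expMeasure ν).ae_le (Lp.coeFn_add f g)] with t ht
      rw [ht, Pi.add_apply, smul_add]
    have hd : Continuous (deriv φ) := hφ.continuous_deriv (by simp)
    have e1 := hp φ hφ hc
    have e2 := hq φ hφ hc
    change ∫ t, deriv φ t • ((p.1 + q.1 : WeightedL2 H ν) : ℝ → H) t
      = -∫ t, φ t • ((p.2 + q.2 : WeightedL2 H ν) : ℝ → H) t
    rw [key _ _ _ hd hc.deriv, key _ _ _ hφ.continuous hc, e1, e2, neg_add]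
  smul_mem' := by
    intro c p hp φ hφ hc
    have key : ∀ (f : WeightedL2 H ν) (ψ : ℝ → ℝ),
        ∫ t, ψ t • ((c • f : WeightedL2 H ν) : ℝ → H) t = c • ∫ t, ψ t • f t := by
      intro f ψ
      rw [← integral_smul]
      refine integral_congr_ae ?_
      filter_upwards [(volume_ac_expMeasure ν).ae_le (Lp.coeFn_smul c f)] with t ht
      rw [ht, Pi.smul_apply, smul_comm]
    have e1 := hp φ hφ hc
    change ∫ t, deriv φ t • ((c • p.1 : WeightedL2 H ν) : ℝ → H) t
      = -∫ t, φ t • ((c • p.2 : WeightedL2 H ν) : ℝ → H) t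
    rw [key, key, e1, smul_neg]

/-- Weak derivatives are unique. -/
theorem weakDerivGraph_unique [CompleteSpace H] {ν : ℝ} (p : WeightedL2 H ν × WeightedL2 H ν)
    (hp : p ∈ weakDerivGraph H ν) (h1 : p.1 = 0) : p.2 = 0 := by
  have h0 : ∀ᵐ t ∂(volume : Measure ℝ), (p.1 : ℝ → H) t = 0 := by
    rw [h1]
    exact (volume_ac_expMeasure ν).ae_le (Lp.coeFn_zero H 2 (expMeasure ν))
  have h2 : ∀ᵐ t ∂(volume : Measure ℝ), (p.2 : ℝ → H) t = 0 := by
    refine ae_eq_zero_of_integral_contDiff_smul_eq_zero (locallyIntegrable p.2) ?_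
    intro φ hφ hc
    have e := hp φ hφ hc
    have e0 : ∫ t, deriv φ t • (p.1 : ℝ → H) t = 0 := by
      refine integral_eq_zero_of_ae ?_
      filter_upwards [h0] with t ht
      simp [ht]
    rw [e0] at e
    exact neg_eq_zero.1 e.symm
  refine Lp.ext ?_
  have h3 : (p.2 : ℝ → H) =ᵐ[expMeasure ν] 0 :=
    (withDensity_absolutelyContinuous _ _).ae_le h2
  exact h3.trans (Lp.coeFn_zero H 2 (expMeasure ν)).symm

variable (H) in
/-- The derivative `∂_{0,ν}` on `L_{2,ν}(ℝ; H)` with domain `H¹_ν(ℝ; H)`, the space of all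
`f ∈ L_{2,ν}(ℝ; H)` that have a weak derivative in `L_{2,ν}(ℝ; H)`. -/
def timeDeriv (ν : ℝ) : WeightedL2 H ν →ₗ.[ℂ] WeightedL2 H ν :=
  (weakDerivGraph H ν).toLinearPMap

theorem mem_graph_timeDeriv [CompleteSpace H] {ν : ℝ} (f g : WeightedL2 H ν) :
    (f, g) ∈ (timeDeriv H ν).graph ↔ IsWeakDeriv (f : ℝ → H) (g : ℝ → H) := by
  rw [timeDeriv, Submodule.toLinearPMap_graph_eq _ weakDerivGraph_unique]
  exact Iff.rfl

/-- The bounded operator `(B f)(t) = B (f t)` on `L_{2,ν}(ℝ; H)`, as an operator with full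
domain. -/
def liftOp (B : H →L[ℂ] H) (ν : ℝ) : WeightedL2 H ν →ₗ.[ℂ] WeightedL2 H ν :=
  (B.compLpL 2 (expMeasure ν) : WeightedL2 H ν →L[ℂ] WeightedL2 H ν).toLinearMap.toPMap ⊤

/-- The operator `∂_{0,ν} E + A` on `L_{2,ν}(ℝ; H)`, with its natural domain
`{u | E u ∈ H¹_ν(ℝ; H)}`. -/
def daeOp (E A : H →L[ℂ] H) (ν : ℝ) : WeightedL2 H ν →ₗ.[ℂ] WeightedL2 H ν :=
  opComp (timeDeriv H ν) (liftOp E ν) + liftOp A ν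

/-- The operator `∂_{0,ν}^{-k} (∂_{0,ν} E + A)⁻¹` on `L_{2,ν}(ℝ; H)` with its natural domain.
(`LinearPMap.inverse` is the inverse of an injective operator, defined on its range.) -/
def solOp (E A : H →L[ℂ] H) (ν : ℝ) (k : ℕ) : WeightedL2 H ν →ₗ.[ℂ] WeightedL2 H ν :=
  opComp (opPow (timeDeriv H ν).inverse k) (daeOp E A ν).inverse

end WeightedL2

end DAE

end

/-! The Fourier–Laplace transform `f ↦ 𝓕 (exp(-ν·) f)` is unitary from `L_{2,ν}` onto `L_2`. It
turns `∂_{0,ν}` into multiplication by `s = ν + 2πix` (`mem_graph_timeDeriv_iff`) and commutes with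
constant operators (`fourierLaplace_compLp`). So `∂_{0,ν} E + A` becomes multiplication by `sE + A`,
and the operator to be extended becomes multiplication by `s^{-k} (sE + A)⁻¹`, the `symbol`.

The hypotheses concern the open half-plane `Re s > ν`, while the symbol is needed on the line `Re s
= ν`. There the resolvent exists by a Neumann series, since the estimate stays finite on approach to
the line, and the estimate itself survives by continuity. The symbol is thus bounded by `C`, and `S`
is the corresponding `multiplier`. Injectivity is pointwise invertibility of `sE + A`. The domain is
dense because it contains every function whose transform is a Schwartz function.

Causality is a Paley–Wiener argument. Take `exp(-ν·) f` smooth with compact support in `[a, ∞)` and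
a test function supported left of `b < a`. The pairing of the test function with `exp(-ν·) S f` is
an integral over the imaginary axis of a function holomorphic on the closed right half-plane that
decays like `exp(-2π(a-b) Re w) (1 + (Im w)²)⁻¹`. Shifting the contour to the right shows that it is
zero (`integral_laplace_symbol_eq_zero`). A cutoff and density give all `f`, and `b` is arbitrary
below `a`. -/

noncomputable section

namespace DAE

/-! ### Removing the exponential weight -/

section Weight

variable {H : Type*} [NormedAddCommGroup H] [InnerProductSpace ℂ H]

theorem ae_expMeasure (ν : ℝ) : ae (expMeasure ν) = ae (volume : Measure ℝ) :=
  le_antisymm (withDensity_absolutelyContinuous _ _).ae_le (volume_ac_expMeasure ν).ae_le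

/-- The density `exp(-2νt)` is the square of the factor `exp(-νt)`, which matches the exponent 2 of
the norm. -/
theorem eLpNorm_expMeasure (ν : ℝ) (f : ℝ → H) :
    eLpNorm f 2 (expMeasure ν) = eLpNorm (fun t => Real.exp (-ν * t) • f t) 2 volume := by
  rw [eLpNorm_eq_lintegral_rpow_enorm_toReal (by norm_num) (by norm_num),
    eLpNorm_eq_lintegral_rpow_enorm_toReal (by norm_num) (by norm_num), expMeasure,
    lintegral_withDensity_eq_lintegral_mul_non_measurable _ (by fun_prop)
      (ae_of_all _ fun t => ENNReal.ofReal_lt_top)]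
  congr 1
  refine lintegral_congr fun t => ?_
  rw [Pi.mul_apply, enorm_smul, ENNReal.mul_rpow_of_nonneg _ _ (by positivity)]
  congr 1
  rw [Real.enorm_eq_ofReal (Real.exp_pos _).le,
    ENNReal.ofReal_rpow_of_nonneg (Real.exp_pos _).le (by positivity), ← Real.exp_mul]
  congr 2
  simp
  ring

theorem memLp_expMeasure_iff {ν : ℝ} {f : ℝ → H} :
    MemLp f 2 (expMeasure ν) ↔ MemLp (fun t => Real.exp (-ν * t) • f t) 2 volume := by
  have hc : ∀ c : ℝ, AEStronglyMeasurable (fun t : ℝ => Real.exp (c * t)) volume := fun c =>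
    (by fun_prop : Continuous fun t : ℝ => Real.exp (c * t)).aestronglyMeasurable
  have hm : AEStronglyMeasurable f (expMeasure ν) ↔
      AEStronglyMeasurable (fun t => Real.exp (-ν * t) • f t) volume := by
    constructor
    · exact fun h => (hc _).smul (h.mono_ac (volume_ac_expMeasure ν))
    · intro h
      refine AEStronglyMeasurable.mono_ac (withDensity_absolutelyContinuous _ _) ?_
      refine ((hc ν).smul h).congr (ae_of_all _ fun t => ?_)
      change Real.exp (ν * t) • Real.exp (-ν * t) • f t = f t
      rw [smul_smul, ← Real.exp_add]
      simp
  rw [MemLp, MemLp, hm, eLpNorm_expMeasure]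

theorem memLp_exp_smul {ν : ℝ} (f : WeightedL2 H ν) :
    MemLp (fun t => Real.exp (-ν * t) • f t) 2 volume :=
  memLp_expMeasure_iff.1 (Lp.memLp f)

theorem memLp_exp_neg_smul {ν : ℝ} (f : Lp H 2 (volume : Measure ℝ)) :
    MemLp (fun t => Real.exp (ν * t) • f t) 2 (expMeasure ν) := by
  refine memLp_expMeasure_iff.2 ((Lp.memLp f).ae_eq (ae_of_all _ fun t => ?_))
  simp only [smul_smul, ← Real.exp_add]
  simp

variable (H) in
/-- The unitary map `f ↦ exp(-ν ·) f` from `L_{2,ν}(ℝ; H)` onto `L_2(ℝ; H)`. -/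
def weightEquiv (ν : ℝ) : WeightedL2 H ν ≃ₗᵢ[ℂ] Lp H 2 (volume : Measure ℝ) where
  toFun f := (memLp_exp_smul f).toLp
  invFun f := (memLp_exp_neg_smul f).toLp
  map_add' f g := by
    rw [← MemLp.toLp_add]
    refine MemLp.toLp_congr _ _ ?_
    filter_upwards [ae_expMeasure ν ▸ Lp.coeFn_add f g] with t ht
    change Real.exp (-ν * t) • (f + g : WeightedL2 H ν) t = _
    rw [ht, Pi.add_apply, smul_add]
    rfl
  map_smul' c f := by
    rw [RingHom.id_apply, ← MemLp.toLp_const_smul]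
    refine MemLp.toLp_congr _ _ ?_
    filter_upwards [ae_expMeasure ν ▸ Lp.coeFn_smul c f] with t ht
    change Real.exp (-ν * t) • (c • f : WeightedL2 H ν) t = _
    rw [ht, Pi.smul_apply, smul_comm]
    rfl
  left_inv f := by
    refine Lp.ext ((MemLp.coeFn_toLp _).trans ?_)
    rw [ae_expMeasure]
    filter_upwards [(memLp_exp_smul f).coeFn_toLp] with t ht
    rw [ht, smul_smul, ← Real.exp_add]
    simp
  right_inv f := by
    refine Lp.ext ((MemLp.coeFn_toLp _).trans ?_)
    filter_upwards [ae_expMeasure ν ▸ (memLp_exp_neg_smul (ν := ν) f).coeFn_toLp] with t ht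
    rw [ht, smul_smul, ← Real.exp_add]
    simp
  norm_map' f := by
    change ‖(memLp_exp_smul f).toLp‖ = _
    rw [Lp.norm_toLp, ← eLpNorm_expMeasure, Lp.norm_def]

theorem coeFn_weightEquiv {ν : ℝ} (f : WeightedL2 H ν) :
    weightEquiv H ν f =ᵐ[volume] fun t => Real.exp (-ν * t) • f t :=
  (memLp_exp_smul f).coeFn_toLp

/-- The weight never vanishes, so supports may be examined after passing to `L_2`. -/
theorem weightEquiv_ae_eq_zero_iff {ν : ℝ} (f : WeightedL2 H ν) (s : Set ℝ) :
    (∀ᵐ t, t ∈ s → weightEquiv H ν f t = 0) ↔ ∀ᵐ t, t ∈ s → f t = 0 := by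
  refine eventually_congr ?_
  filter_upwards [coeFn_weightEquiv f] with t ht
  rw [ht, smul_eq_zero_iff_right (Real.exp_pos _).ne']

end Weight

/-! ### Operator-valued multiplication on `L_2` -/

section Multiplication

variable {H : Type*} [NormedAddCommGroup H] [InnerProductSpace ℂ H]

/-- Multiplication by an essentially bounded operator-valued function on `L_2(ℝ; H)`. -/
def mulOp (M : Lp (H →L[ℂ] H) ∞ (volume : Measure ℝ)) :
    Lp H 2 (volume : Measure ℝ) →L[ℂ] Lp H 2 (volume : Measure ℝ) :=
  (ContinuousLinearMap.id ℂ (H →L[ℂ] H)).holderL volume ∞ 2 2 M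

theorem coeFn_mulOp (M : Lp (H →L[ℂ] H) ∞ (volume : Measure ℝ))
    (f : Lp H 2 (volume : Measure ℝ)) : mulOp M f =ᵐ[volume] fun t => M t (f t) :=
  (ContinuousLinearMap.id ℂ (H →L[ℂ] H)).coeFn_holder M f

theorem memLp_top_of_continuous {B : Type*} [NormedAddCommGroup B] {M : ℝ → B}
    (hM : Continuous M) {C : ℝ} (hC : ∀ t, ‖M t‖ ≤ C) : MemLp M ∞ volume :=
  memLp_top_of_bound hM.aestronglyMeasurable C (ae_of_all _ hC)

end Multiplication

/-! ### Weak derivatives under the Fourier transform -/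

section Fourier

open scoped SchwartzMap FourierTransform LineDeriv

variable {H : Type*} [NormedAddCommGroup H] [InnerProductSpace ℂ H]

theorem integrable_schwartz_smul (F : Lp H 2 (volume : Measure ℝ)) (ψ : 𝓢(ℝ, ℂ)) :
    Integrable (fun x => ψ x • F x) :=
  memLp_one_iff_integrable.1 ((Lp.memLp F).smul (ψ.memLp 2 volume))

/-- `IsWeakDeriv` tests with real functions only; real and imaginary parts are treated separately.
-/
theorem isWeakDeriv_complex {F G : Lp H 2 (volume : Measure ℝ)} (h : IsWeakDeriv F G)
    {φ : ℝ → ℂ} (hφ : ContDiff ℝ ∞ φ) (hc : HasCompactSupport φ) :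
    ∫ t, deriv φ t • F t = -∫ t, φ t • G t := by
  have hloc : ∀ F : Lp H 2 (volume : Measure ℝ), LocallyIntegrable F volume := fun F =>
    (Lp.memLp F).locallyIntegrable (by norm_num)
  have split : ∀ (F : Lp H 2 (volume : Measure ℝ)) (ψ : ℝ → ℂ), Continuous ψ →
      HasCompactSupport ψ → ∫ t, ψ t • F t
        = (∫ t, (ψ t).re • F t) + Complex.I • ∫ t, (ψ t).im • F t := by
    intro F ψ hψ hψc
    have h1 : Integrable (fun t => (ψ t).re • F t) volume :=
      (hloc F).integrable_smul_left_of_hasCompactSupport (Complex.continuous_re.comp hψ)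
        (hψc.comp_left (g := Complex.re) rfl)
    have h2 : Integrable (fun t => (ψ t).im • F t) volume :=
      (hloc F).integrable_smul_left_of_hasCompactSupport (Complex.continuous_im.comp hψ)
        (hψc.comp_left (g := Complex.im) rfl)
    rw [← integral_smul]
    refine Eq.trans ?_ (integral_add h1 (h2.smul Complex.I))
    refine integral_congr_ae (ae_of_all _ fun t => ?_)
    beta_reduce
    conv_lhs => rw [← Complex.re_add_im (ψ t), add_smul, mul_comm, mul_smul]
    simp
  have hd : ∀ t, HasDerivAt φ (deriv φ t) t := fun t =>
    (hφ.differentiable (by simp)).differentiableAt.hasDerivAt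
  have hre : ∀ t, (deriv φ t).re = deriv (fun t => (φ t).re) t := fun t =>
    ((Complex.reCLM.hasFDerivAt.comp_hasDerivAt t (hd t)).deriv).symm
  have him : ∀ t, (deriv φ t).im = deriv (fun t => (φ t).im) t := fun t =>
    ((Complex.imCLM.hasFDerivAt.comp_hasDerivAt t (hd t)).deriv).symm
  rw [split F _ (hφ.continuous_deriv (by simp)) hc.deriv, split G _ hφ.continuous hc]
  simp only [hre, him]
  rw [h (fun t => (φ t).re) (Complex.reCLM.contDiff.comp hφ)
      (hc.comp_left (g := Complex.re) rfl),
    h (fun t => (φ t).im) (Complex.imCLM.contDiff.comp hφ)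
      (hc.comp_left (g := Complex.im) rfl), smul_neg, neg_add]

/-- Needed because the Fourier transform of a test function is merely Schwartz. Cutting off with `χ
(x / (n + 1))` costs a product-rule term with the factor `1 / (n + 1)`, which vanishes in the limit
by dominated convergence. -/
theorem isWeakDeriv_schwartz {F G : Lp H 2 (volume : Measure ℝ)} (h : IsWeakDeriv F G)
    (ψ : 𝓢(ℝ, ℂ)) : ∫ t, deriv ψ t • F t = -∫ t, ψ t • G t := by
  let χ : ContDiffBump (0 : ℝ) := ⟨1, 2, by norm_num, by norm_num⟩
  have hχ : ContDiff ℝ ∞ χ := χ.contDiff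
  obtain ⟨K, hK⟩ := χ.hasCompactSupport.deriv.exists_bound_of_continuous
    (hχ.continuous_deriv (by simp))
  let r : ℕ → ℝ := fun n => ((n : ℝ) + 1)⁻¹
  have hr0 : ∀ n, 0 < r n := fun n => by positivity
  have hr1 : ∀ n, r n ≤ 1 := fun n => inv_le_one_of_one_le₀ (by simp)
  have hr : Tendsto r atTop (𝓝 0) := by
    simpa only [one_div] using tendsto_one_div_add_atTop_nhds_zero_nat (𝕜 := ℝ)
  let φ : ℕ → ℝ → ℂ := fun n x => (χ (r n * x) : ℝ) • ψ x
  have hψ : ContDiff ℝ ∞ ψ := ψ.smooth ⊤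
  have hφ : ∀ n, ContDiff ℝ ∞ (φ n) := fun n =>
    (hχ.comp (contDiff_const.mul contDiff_id)).smul hψ
  have hφc : ∀ n, HasCompactSupport (φ n) := fun n =>
    (χ.hasCompactSupport.comp_homeomorph (Homeomorph.mulLeft₀ (r n) (hr0 n).ne')).smul_right
  have hφd : ∀ n x, deriv (φ n) x = (r n * deriv χ (r n * x)) • ψ x + χ (r n * x) • deriv ψ x := by
    intro n x
    have h1 : HasDerivAt (fun x => χ (r n * x)) (deriv χ (r n * x) * r n) x := by
      have h0 : HasDerivAt (fun x => r n * x) (r n) x := by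
        simpa using (hasDerivAt_id x).const_mul (r n)
      exact (hχ.differentiable (by simp) (r n * x)).hasDerivAt.comp x h0
    refine (h1.smul (ψ.hasDerivAt x)).deriv.trans ?_
    rw [add_comm, mul_comm]
  have hlim : ∀ x, Tendsto (fun n => r n * x) atTop (𝓝 0) := fun x => by
    simpa using hr.mul_const x
  have hχlim : ∀ x, Tendsto (fun n => χ (r n * x)) atTop (𝓝 1) := fun x => by
    have := (hχ.continuous.tendsto 0).comp (hlim x)
    rwa [χ.one_of_mem_closedBall (by simp [χ])] at this
  have hdχlim : ∀ x, Tendsto (fun n => r n * deriv χ (r n * x)) atTop (𝓝 0) := fun x => by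
    have := hr.mul (((hχ.continuous_deriv (by simp)).tendsto 0).comp (hlim x))
    simpa using this
  have hdψ : Integrable (fun x => deriv ψ x • F x) := by
    simpa using integrable_schwartz_smul F (SchwartzMap.derivCLM ℂ ℂ ψ)
  have hχ1 : ∀ x, ‖χ x‖ ≤ 1 := fun x => by
    rw [Real.norm_of_nonneg χ.nonneg]; exact χ.le_one
  have lim1 : Tendsto (fun n => ∫ t, deriv (φ n) t • F t) atTop (𝓝 (∫ t, deriv ψ t • F t)) := by
    refine tendsto_integral_of_dominated_convergence
      (fun x => K * ‖ψ x • F x‖ + ‖deriv ψ x • F x‖) (fun n => ?_)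
      (((integrable_schwartz_smul F ψ).norm.const_mul K).add hdψ.norm) (fun n => ?_) ?_
    · exact ((hφ n).continuous_deriv (by simp)).aestronglyMeasurable.smul
        (Lp.aestronglyMeasurable F)
    · refine ae_of_all _ fun x => ?_
      rw [hφd, add_smul, smul_assoc, smul_assoc]
      refine (norm_add_le _ _).trans (add_le_add ?_ ?_)
      · rw [norm_smul]
        refine mul_le_mul_of_nonneg_right ?_ (norm_nonneg _)
        rw [norm_mul, Real.norm_of_nonneg (hr0 n).le]
        exact (mul_le_of_le_one_left (norm_nonneg _) (hr1 n)).trans (hK _)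
      · rw [norm_smul]
        exact mul_le_of_le_one_left (norm_nonneg _) (hχ1 _)
    · refine ae_of_all _ fun x => ?_
      simp only [hφd]
      have := (((hdχlim x).smul_const (ψ x)).add
        ((hχlim x).smul_const (deriv ψ x))).smul_const (F x)
      simpa using this
  have lim2 : Tendsto (fun n => ∫ t, φ n t • G t) atTop (𝓝 (∫ t, ψ t • G t)) := by
    refine tendsto_integral_of_dominated_convergence
      (fun x => ‖ψ x • G x‖) (fun n => ?_)
      (integrable_schwartz_smul G ψ).norm (fun n => ?_) ?_
    · exact (hφ n).continuous.aestronglyMeasurable.smul (Lp.aestronglyMeasurable G)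
    · refine ae_of_all _ fun x => ?_
      rw [smul_assoc, norm_smul]
      exact mul_le_of_le_one_left (norm_nonneg _) (hχ1 _)
    · refine ae_of_all _ fun x => ?_
      have := ((hχlim x).smul_const (ψ x)).smul_const (G x)
      simpa [φ] using this
  refine tendsto_nhds_unique lim1 ?_
  simp only [fun n => isWeakDeriv_complex h (hφ n) (hφc n)]
  exact lim2.neg

variable [CompleteSpace H]

theorem integral_smul_fourier (F : Lp H 2 (volume : Measure ℝ)) (ψ : 𝓢(ℝ, ℂ)) :
    ∫ x, ψ x • (𝓕 F : Lp H 2 (volume : Measure ℝ)) x = ∫ x, 𝓕 ψ x • F x := by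
  have := DFunLike.congr_fun (Lp.fourier_toTemperedDistribution_eq F) ψ
  simpa using this.symm

theorem integral_smul_eq_fourierInv_smul_fourier (F : Lp H 2 (volume : Measure ℝ))
    (ψ : 𝓢(ℝ, ℂ)) :
    ∫ x, ψ x • F x = ∫ x, 𝓕⁻ ψ x • (𝓕 F : Lp H 2 (volume : Measure ℝ)) x := by
  rw [integral_smul_fourier, FourierTransform.fourier_fourierInv_eq]

/-- The complex test function belonging to a real one. -/
def testFunction {φ : ℝ → ℝ} (hφ : ContDiff ℝ ∞ φ) (hc : HasCompactSupport φ) : 𝓢(ℝ, ℂ) :=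
  (hc.comp_left (g := Complex.ofRealCLM) (by simp)).toSchwartzMap
    (Complex.ofRealCLM.contDiff.comp hφ)

theorem testFunction_apply {φ : ℝ → ℝ} (hφ : ContDiff ℝ ∞ φ) (hc : HasCompactSupport φ) (x : ℝ) :
    testFunction hφ hc x = φ x := rfl

theorem lp_ext_of_integral_schwartz {F G : Lp H 2 (volume : Measure ℝ)}
    (h : ∀ ψ : 𝓢(ℝ, ℂ), ∫ x, ψ x • F x = ∫ x, ψ x • G x) : F = G := by
  refine Lp.ext (ae_eq_of_integral_contDiff_smul_eq
    ((Lp.memLp F).locallyIntegrable (by norm_num)) ((Lp.memLp G).locallyIntegrable (by norm_num))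
    fun φ hφ hc => ?_)
  simpa [testFunction_apply] using h (testFunction hφ hc)

theorem fourierInv_deriv_apply (ψ : 𝓢(ℝ, ℂ)) (x : ℝ) :
    𝓕⁻ (SchwartzMap.derivCLM ℂ ℂ ψ) x = -(2 * Real.pi * Complex.I * x) * 𝓕⁻ ψ x := by
  have h : SchwartzMap.derivCLM ℂ ℂ ψ = ∂_{(1 : ℝ)} ψ := by
    ext t
    simp [SchwartzMap.lineDerivOp_apply_eq_fderiv]
  rw [h, SchwartzMap.fourierInv_lineDerivOp_eq]
  have : (inner ℝ · (1 : ℝ)).HasTemperateGrowth := by fun_prop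
  rw [smul_apply, SchwartzMap.smulLeftCLM_apply_apply this]
  simp
  ring

theorem deriv_fourier_apply (ψ : 𝓢(ℝ, ℂ)) :
    SchwartzMap.derivCLM ℂ ℂ (𝓕 ψ) =
      𝓕 (SchwartzMap.smulLeftCLM ℂ (fun x : ℝ => -(2 * Real.pi * Complex.I * x)) ψ) := by
  have h1 : (fun x : ℝ => -(2 * Real.pi * Complex.I * x)).HasTemperateGrowth := by fun_prop
  rw [← FourierTransform.fourier_fourierInv_eq (F := 𝓢(ℝ, ℂ))
    (SchwartzMap.derivCLM ℂ ℂ (𝓕 ψ))]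
  congr 1
  ext x
  rw [fourierInv_deriv_apply, FourierTransform.fourierInv_fourier_eq,
    SchwartzMap.smulLeftCLM_apply_apply h1, smul_eq_mul]

/-- The Fourier transform turns the weak derivative on `L_2(ℝ; H)` into multiplication. -/
theorem isWeakDeriv_iff_fourier {F G : Lp H 2 (volume : Measure ℝ)} :
    IsWeakDeriv F G ↔ (𝓕 G : Lp H 2 (volume : Measure ℝ)) =ᵐ[volume]
      fun x : ℝ => (2 * Real.pi * Complex.I * x) • (𝓕 F : Lp H 2 (volume : Measure ℝ)) x := by
  constructor
  · intro h
    refine ae_eq_of_integral_contDiff_smul_eq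
      ((Lp.memLp _).locallyIntegrable (by norm_num)) ?_ fun φ hφ hc => ?_
    · have := ((locallyIntegrableOn_univ (μ := (volume : Measure ℝ))).2
        ((Lp.memLp (𝓕 F : Lp H 2 (volume : Measure ℝ))).locallyIntegrable
          (by norm_num))).continuousOn_smul isOpen_univ.isLocallyClosed
        (by fun_prop : Continuous fun x : ℝ => 2 * Real.pi * Complex.I * x).continuousOn
      exact locallyIntegrableOn_univ.1 this
    · have h1 : (fun x : ℝ => -(2 * Real.pi * Complex.I * x)).HasTemperateGrowth := by fun_prop
      have e1 := integral_smul_fourier G (testFunction hφ hc)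
      have e2 := isWeakDeriv_schwartz h (𝓕 (testFunction hφ hc))
      have e3 := integral_smul_fourier F
        (SchwartzMap.smulLeftCLM ℂ (fun x : ℝ => -(2 * Real.pi * Complex.I * x))
          (testFunction hφ hc))
      rw [← deriv_fourier_apply] at e3
      simp only [SchwartzMap.derivCLM_apply] at e3
      rw [e2, ← e1] at e3
      simp only [SchwartzMap.smulLeftCLM_apply_apply h1, testFunction_apply] at e3
      simp only [Complex.coe_smul] at e3
      rw [← neg_inj, ← e3, ← integral_neg]
      refine integral_congr_ae (ae_of_all _ fun x => ?_)
      simp only [smul_eq_mul, neg_mul, neg_smul, mul_smul, neg_inj]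
      simp only [Complex.coe_smul]
      simp only [smul_comm (φ x)]
  · intro h φ hφ hc
    have e1 := integral_smul_eq_fourierInv_smul_fourier G (testFunction hφ hc)
    have e2 := integral_smul_eq_fourierInv_smul_fourier F
      (SchwartzMap.derivCLM ℂ ℂ (testFunction hφ hc))
    have hd : ∀ t, SchwartzMap.derivCLM ℂ ℂ (testFunction hφ hc) t = (deriv φ t : ℝ) := fun t => by
      rw [SchwartzMap.derivCLM_apply]
      exact ((hφ.differentiable (by simp) t).hasDerivAt.ofReal_comp).deriv
    simp only [hd, testFunction_apply, Complex.coe_smul] at e1 e2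
    rw [e1, e2, ← integral_neg]
    refine integral_congr_ae ?_
    filter_upwards [h] with x hx
    rw [hx, fourierInv_deriv_apply, neg_mul, neg_smul, smul_smul, mul_comm]

/-- Tested against Schwartz functions, the constant operator `B` moves out of the integral. -/
theorem fourier_compLp (B : H →L[ℂ] H) (F : Lp H 2 (volume : Measure ℝ)) :
    (𝓕 (B.compLp F) : Lp H 2 (volume : Measure ℝ)) =
      B.compLp (𝓕 F : Lp H 2 (volume : Measure ℝ)) := by
  have key : ∀ (F : Lp H 2 (volume : Measure ℝ)) (ψ : 𝓢(ℝ, ℂ)),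
      ∫ x, ψ x • B.compLp F x = B (∫ x, ψ x • F x) := fun F ψ => by
    rw [← B.integral_comp_comm (integrable_schwartz_smul F ψ)]
    refine integral_congr_ae ?_
    filter_upwards [B.coeFn_compLp F] with x hx
    rw [hx, map_smul]
  refine lp_ext_of_integral_schwartz fun ψ => ?_
  rw [integral_smul_fourier, key, key, integral_smul_fourier]

end Fourier

/-! ### The Fourier–Laplace transform -/

section FourierLaplace

open scoped FourierTransform

variable {H : Type*} [NormedAddCommGroup H] [InnerProductSpace ℂ H]

/-- This is the product rule `(exp(-νt) f)' = exp(-νt) (f' - ν f)`; weakly, the exponential is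
absorbed into the test function. -/
theorem isWeakDeriv_iff_weightEquiv {ν : ℝ} {f g : WeightedL2 H ν} :
    IsWeakDeriv f g ↔
      IsWeakDeriv (weightEquiv H ν f)
        (weightEquiv H ν g - (ν : ℂ) • weightEquiv H ν f : Lp H 2 _) := by
  have hloc : ∀ F : Lp H 2 (volume : Measure ℝ), LocallyIntegrable F volume := fun F =>
    (Lp.memLp F).locallyIntegrable (by norm_num)
  have hexp : ∀ c : ℝ, ContDiff ℝ ∞ fun t : ℝ => Real.exp (c * t) := fun c => by fun_prop
  have hder : ∀ {φ : ℝ → ℝ}, ContDiff ℝ ∞ φ → ∀ c t, deriv (fun t => Real.exp (c * t) * φ t) t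
      = Real.exp (c * t) * (c * φ t + deriv φ t) := by
    intro φ hφ c t
    have h0 : HasDerivAt (fun t : ℝ => c * t) c t := by
      simpa using (hasDerivAt_id t).const_mul c
    refine (h0.exp.mul (hφ.differentiable (by simp) t).hasDerivAt).deriv.trans ?_
    ring
  have hsub : ∀ {φ : ℝ → ℝ}, ContDiff ℝ ∞ φ → HasCompactSupport φ →
      ∫ t, φ t • (weightEquiv H ν g - (ν : ℂ) • weightEquiv H ν f : Lp H 2 _) t
        = (∫ t, φ t • weightEquiv H ν g t) - ∫ t, (ν * φ t) • weightEquiv H ν f t := by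
    intro φ hφ hc
    rw [← integral_sub
      ((hloc _).integrable_smul_left_of_hasCompactSupport hφ.continuous hc)
      ((hloc _).integrable_smul_left_of_hasCompactSupport (g := fun t => ν * φ t)
        (continuous_const.mul hφ.continuous) hc.mul_left)]
    refine integral_congr_ae ?_
    filter_upwards [Lp.coeFn_sub (weightEquiv H ν g) ((ν : ℂ) • weightEquiv H ν f),
      Lp.coeFn_smul (ν : ℂ) (weightEquiv H ν f)] with t h1 h2
    rw [h1, Pi.sub_apply, h2, Pi.smul_apply, smul_sub, Complex.coe_smul, smul_smul, mul_comm]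
  have hW : ∀ (f : WeightedL2 H ν) (φ ψ : ℝ → ℝ), (∀ t, φ t = Real.exp (-ν * t) * ψ t) →
      ∫ t, φ t • f t = ∫ t, ψ t • weightEquiv H ν f t := by
    intro f φ ψ h
    refine integral_congr_ae ?_
    filter_upwards [coeFn_weightEquiv f] with t ht
    rw [ht, h, smul_smul, mul_comm]
  have key : ∀ {φ : ℝ → ℝ}, ContDiff ℝ ∞ φ → HasCompactSupport φ →
      ((∫ t, deriv (fun t => Real.exp (-ν * t) * φ t) t • f t
          = -∫ t, (Real.exp (-ν * t) * φ t) • g t) ↔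
        ∫ t, deriv φ t • weightEquiv H ν f t =
          -∫ t, φ t • (weightEquiv H ν g - (ν : ℂ) • weightEquiv H ν f : Lp H 2 _) t) := by
    intro φ hφ hc
    have e : ∫ t, (-ν * φ t + deriv φ t) • weightEquiv H ν f t
        = (∫ t, deriv φ t • weightEquiv H ν f t) - ∫ t, (ν * φ t) • weightEquiv H ν f t := by
      rw [← integral_sub
        ((hloc _).integrable_smul_left_of_hasCompactSupport (hφ.continuous_deriv (by simp))
          hc.deriv)
        ((hloc _).integrable_smul_left_of_hasCompactSupport (g := fun t => ν * φ t)
          (continuous_const.mul hφ.continuous) hc.mul_left)]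
      refine integral_congr_ae (ae_of_all _ fun t => ?_)
      beta_reduce
      rw [← sub_smul]
      ring_nf
    rw [hW f _ _ (hder hφ (-ν)), hW g _ φ fun t => rfl, hsub hφ hc, e, sub_eq_iff_eq_add,
      neg_sub, neg_add_eq_sub]
  constructor
  · intro h φ hφ hc
    exact (key hφ hc).1 (h _ ((hexp _).mul hφ) hc.mul_left)
  · intro h φ hφ hc
    -- The test function `exp(νt) φ` cancels the factor `exp(-νt)` inserted by `key`.
    have e := (key ((hexp ν).mul hφ) hc.mul_left).2 (h _ ((hexp ν).mul hφ) hc.mul_left)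
    have e' : (fun t => Real.exp (-ν * t) * (Real.exp (ν * t) * φ t)) = φ := by
      ext t
      rw [← mul_assoc, ← Real.exp_add]
      simp
    rw [show (fun t => Real.exp (-ν * t) * (Real.exp (ν * t) * φ t)) = φ from e'] at e
    simpa only [congrFun e'] using e

variable [CompleteSpace H]

variable (H) in
/-- The Fourier–Laplace transform, a unitary map from `L_{2,ν}(ℝ; H)` onto `L_2(ℝ; H)`. -/
def fourierLaplace (ν : ℝ) : WeightedL2 H ν ≃ₗᵢ[ℂ] Lp H 2 (volume : Measure ℝ) :=
  (weightEquiv H ν).trans (Lp.fourierTransformₗᵢ ℝ H)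

theorem fourierLaplace_apply {ν : ℝ} (f : WeightedL2 H ν) :
    fourierLaplace H ν f = (𝓕 (weightEquiv H ν f) : Lp H 2 _) := rfl

/-- The point `ν + 2πix` on the line `Re s = ν`. -/
def linePoint (ν x : ℝ) : ℂ := ν + 2 * Real.pi * Complex.I * x

theorem linePoint_re (ν x : ℝ) : (linePoint ν x).re = ν := by
  simp [linePoint]

theorem linePoint_ne_zero {ν : ℝ} (hν : 0 < ν) (x : ℝ) : linePoint ν x ≠ 0 := fun h => by
  have := linePoint_re ν x
  rw [h, Complex.zero_re] at this
  exact hν.ne this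

theorem le_norm_linePoint (ν x : ℝ) : ν ≤ ‖linePoint ν x‖ := by
  simpa [linePoint_re] using Complex.re_le_norm (linePoint ν x)

theorem continuous_linePoint (ν : ℝ) : Continuous (linePoint ν) := by
  unfold linePoint
  fun_prop

/-- The Fourier–Laplace transform turns `∂_{0,ν}` into multiplication by the line variable. -/
theorem mem_graph_timeDeriv_iff {ν : ℝ} {f g : WeightedL2 H ν} :
    (f, g) ∈ (timeDeriv H ν).graph ↔
      fourierLaplace H ν g =ᵐ[volume] fun x => linePoint ν x • fourierLaplace H ν f x := by
  rw [mem_graph_timeDeriv, isWeakDeriv_iff_weightEquiv, isWeakDeriv_iff_fourier,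
    ← fourierLaplace_apply]
  have h : (𝓕 (weightEquiv H ν g - (ν : ℂ) • weightEquiv H ν f : Lp H 2 _) : Lp H 2 _)
      = fourierLaplace H ν g - (ν : ℂ) • fourierLaplace H ν f := by
    rw [fourierLaplace_apply, fourierLaplace_apply]
    exact ((Lp.fourierTransformₗᵢ ℝ H).map_sub _ _).trans
      (congrArg _ ((Lp.fourierTransformₗᵢ ℝ H).map_smul _ _))
  rw [h]
  refine eventually_congr ?_
  filter_upwards [Lp.coeFn_sub (fourierLaplace H ν g) ((ν : ℂ) • fourierLaplace H ν f),
    Lp.coeFn_smul (ν : ℂ) (fourierLaplace H ν f)] with x h1 h2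
  rw [h1, Pi.sub_apply, h2, Pi.smul_apply, linePoint, add_smul, sub_eq_iff_eq_add']

theorem fourierLaplace_compLp {ν : ℝ} (B : H →L[ℂ] H) (f : WeightedL2 H ν) :
    fourierLaplace H ν (B.compLp f) =ᵐ[volume] fun x => B (fourierLaplace H ν f x) := by
  have h : weightEquiv H ν (B.compLp f) = B.compLp (weightEquiv H ν f) := by
    refine Lp.ext ?_
    filter_upwards [coeFn_weightEquiv (B.compLp f), coeFn_weightEquiv f,
      ae_expMeasure ν ▸ B.coeFn_compLp f, B.coeFn_compLp (weightEquiv H ν f)] with t h1 h2 h3 h4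
    rw [h1, h3, h4, h2, ← Complex.coe_smul, ← Complex.coe_smul, map_smul]
  rw [fourierLaplace_apply, h, fourier_compLp]
  exact B.coeFn_compLp _

theorem fourierLaplace_ext {ν : ℝ} {f g : WeightedL2 H ν}
    (h : fourierLaplace H ν f =ᵐ[volume] fourierLaplace H ν g) : f = g :=
  (fourierLaplace H ν).injective (Lp.ext h)

/-- On the line `|s| ≥ Re s = ν > 0`, so division by `s` is a bounded multiplication operator. -/
theorem bijective_timeDeriv {ν : ℝ} (hν : 0 < ν) : Function.Bijective (timeDeriv H ν) := by
  constructor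
  · intro f g hfg
    have hf := mem_graph_timeDeriv_iff.1 ((timeDeriv H ν).mem_graph f)
    have hg := mem_graph_timeDeriv_iff.1 ((timeDeriv H ν).mem_graph g)
    refine Subtype.ext (fourierLaplace_ext ?_)
    filter_upwards [hf, hg] with x h1 h2
    rw [hfg, h2] at h1
    exact (smul_right_injective H (linePoint_ne_zero hν x) h1).symm
  · intro g
    let M : ℝ → H →L[ℂ] H := fun x => (linePoint ν x)⁻¹ • ContinuousLinearMap.id ℂ H
    have hM : MemLp M ∞ volume := by
      refine memLp_top_of_continuous (C := ν⁻¹ * ‖ContinuousLinearMap.id ℂ H‖)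
        (((continuous_linePoint ν).inv₀ (linePoint_ne_zero hν)).smul continuous_const) fun x => ?_
      rw [norm_smul, norm_inv]
      exact mul_le_mul_of_nonneg_right (inv_anti₀ hν (le_norm_linePoint ν x)) (norm_nonneg _)
    let f := (fourierLaplace H ν).symm (mulOp hM.toLp (fourierLaplace H ν g))
    have hfg : (f, g) ∈ (timeDeriv H ν).graph := by
      rw [mem_graph_timeDeriv_iff, LinearIsometryEquiv.apply_symm_apply]
      filter_upwards [coeFn_mulOp hM.toLp (fourierLaplace H ν g), hM.coeFn_toLp] with x h1 h2
      rw [h1, h2]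
      simp [M, smul_smul, linePoint_ne_zero hν x]
    obtain ⟨y, -, hy⟩ := (LinearPMap.mem_graph_iff _).1 hfg
    exact ⟨y, hy⟩

end FourierLaplace

/-! ### The resolvent on the closed half-plane -/

section ClosedHalfPlane

variable {H : Type*} [NormedAddCommGroup H] [InnerProductSpace ℂ H] [CompleteSpace H]
  {E A : H →L[ℂ] H} {ν C : ℝ} {k : ℕ}

/-- A resolvent estimate extends the resolvent set to the closed half-plane. -/
theorem mem_resolventSet_of_le (hρ : {s : ℂ | ν < s.re} ⊆ resolventSet E A) (hC : 0 ≤ C)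
    (hb : ResolventBound E A ν C k) {s : ℂ} (hs : ν ≤ s.re) : s ∈ resolventSet E A := by
  -- As `ε ≤ 1`, the quantity `C (‖s‖ + 1)^k` bounds the resolvent at `s + ε`, which lies in the
  -- open half-plane; `ε` is small enough for a Neumann series around that point to reach `s`.
  obtain ⟨ε, hε0, hε1, hε⟩ : ∃ ε : ℝ, 0 < ε ∧ ε ≤ 1 ∧ C * (‖s‖ + 1) ^ k * ‖E‖ * ε < 1 := by
    have hK : 0 ≤ C * (‖s‖ + 1) ^ k * ‖E‖ := by positivity
    refine ⟨(C * (‖s‖ + 1) ^ k * ‖E‖ + 1)⁻¹, by positivity,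
      inv_le_one_of_one_le₀ (by linarith), ?_⟩
    rw [← div_eq_mul_inv, div_lt_one (by positivity)]
    linarith
  have ht : ν < (s + ε).re := by simpa using lt_of_le_of_lt hs (lt_add_of_pos_right _ hε0)
  have hu : IsUnit ((s + ε) • E + A) := hρ ht
  have hn : ‖resolvent E A (s + ε) * ((ε : ℂ) • E)‖ < 1 := by
    refine lt_of_le_of_lt ?_ hε
    refine (norm_mul_le _ _).trans ?_
    rw [norm_smul, Complex.norm_real, Real.norm_of_nonneg hε0.le, mul_assoc _ ‖E‖, mul_comm ‖E‖]
    refine mul_le_mul_of_nonneg_right ((hb _ ht).trans ?_) (by positivity)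
    gcongr
    refine (norm_add_le _ _).trans ?_
    rw [Complex.norm_real, Real.norm_of_nonneg hε0.le]
    gcongr
  have hfac : s • E + A = ((s + ε) • E + A) * (1 - resolvent E A (s + ε) * ((ε : ℂ) • E)) := by
    rw [mul_sub, mul_one, ← mul_assoc, resolvent, Ring.mul_inverse_cancel _ hu, one_mul, add_smul]
    abel
  change IsUnit (s • E + A)
  rw [hfac]
  exact hu.mul (isUnit_one_sub_of_norm_lt_one hn)

theorem differentiableAt_resolvent {s : ℂ} (hs : s ∈ resolventSet E A) :
    DifferentiableAt ℂ (resolvent E A) s :=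
  DifferentiableAt.comp s (differentiableAt_inverse (𝕜 := ℂ) hs)
    ((differentiableAt_id.smul_const E).add_const A)

/-- The resolvent is continuous at `s`, so the estimate at `s + ε` passes to the limit `ε ↓ 0`. -/
theorem norm_resolvent_le_of_le (hρ : {s : ℂ | ν < s.re} ⊆ resolventSet E A) (hC : 0 ≤ C)
    (hb : ResolventBound E A ν C k) {s : ℂ} (hs : ν ≤ s.re) :
    ‖resolvent E A s‖ ≤ C * ‖s‖ ^ k := by
  have hpath : Tendsto (fun ε : ℝ => s + ε) (𝓝[>] 0) (𝓝 s) := by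
    have : Continuous fun ε : ℝ => s + ε := by fun_prop
    simpa using (this.tendsto 0).mono_left nhdsWithin_le_nhds
  have h1 := (differentiableAt_resolvent
    (mem_resolventSet_of_le hρ hC hb hs)).continuousAt.norm.tendsto.comp hpath
  have h2 : Tendsto (fun s : ℂ => C * ‖s‖ ^ k) (𝓝 s) (𝓝 (C * ‖s‖ ^ k)) :=
    (by fun_prop : Continuous fun s : ℂ => C * ‖s‖ ^ k).tendsto s
  refine le_of_tendsto_of_tendsto h1 (h2.comp hpath) ?_
  filter_upwards [self_mem_nhdsWithin] with ε hε
  exact hb _ (by simpa using lt_of_le_of_lt hs (lt_add_of_pos_right _ hε))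

variable (E A k) in
/-- The symbol `s^{-k} (sE + A)⁻¹`. -/
def symbol (s : ℂ) : H →L[ℂ] H := (s ^ k)⁻¹ • resolvent E A s

theorem differentiableAt_symbol (hν : 0 < ν) (hρ : {s : ℂ | ν < s.re} ⊆ resolventSet E A)
    (hC : 0 ≤ C) (hb : ResolventBound E A ν C k) {s : ℂ} (hs : ν ≤ s.re) :
    DifferentiableAt ℂ (symbol E A k) s := by
  have hs0 : s ≠ 0 := by
    rintro rfl
    exact absurd hs (by simpa using hν)
  exact ((differentiableAt_id.pow k).inv (pow_ne_zero k hs0)).smul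
    (differentiableAt_resolvent (mem_resolventSet_of_le hρ hC hb hs))

theorem norm_symbol_le (hν : 0 < ν) (hρ : {s : ℂ | ν < s.re} ⊆ resolventSet E A)
    (hC : 0 ≤ C) (hb : ResolventBound E A ν C k) {s : ℂ} (hs : ν ≤ s.re) :
    ‖symbol E A k s‖ ≤ C := by
  have hs0 : s ≠ 0 := by
    rintro rfl
    exact absurd hs (by simpa using hν)
  rw [symbol, norm_smul, norm_inv, norm_pow, inv_mul_le_iff₀ (by positivity), mul_comm]
  exact norm_resolvent_le_of_le hρ hC hb hs

theorem memLp_symbol (hν : 0 < ν) (hρ : {s : ℂ | ν < s.re} ⊆ resolventSet E A)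
    (hC : 0 ≤ C) (hb : ResolventBound E A ν C k) :
    MemLp (fun x => symbol E A k (linePoint ν x)) ∞ volume := by
  refine memLp_top_of_continuous (C := C) ?_ fun x =>
    norm_symbol_le hν hρ hC hb (linePoint_re ν x).ge
  exact continuous_iff_continuousAt.2 fun x => ContinuousAt.comp
    (differentiableAt_symbol hν hρ hC hb (linePoint_re ν x).ge).continuousAt
    (continuous_linePoint ν).continuousAt

end ClosedHalfPlane

/-! ### The solution operator as a multiplier, and its dense domain -/

section SolutionOperator

variable {H : Type*} [NormedAddCommGroup H] [InnerProductSpace ℂ H]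

theorem mem_graph_liftOp {B : H →L[ℂ] H} {ν : ℝ} {f g : WeightedL2 H ν} :
    (f, g) ∈ (liftOp B ν).graph ↔ B.compLp f = g := by
  rw [LinearPMap.mem_graph_iff]
  constructor
  · rintro ⟨y, hy, hg⟩
    simp only at hy hg
    rw [← hg, ← hy]
    rfl
  · intro h
    exact ⟨⟨f, trivial⟩, rfl, h⟩

theorem mem_graph_add {X Y : Type*} [AddCommGroup X] [Module ℂ X] [AddCommGroup Y] [Module ℂ Y]
    {f g : X →ₗ.[ℂ] Y} {x : X} {y : Y} :
    (x, y) ∈ (f + g).graph ↔ ∃ a b, (x, a) ∈ f.graph ∧ (x, b) ∈ g.graph ∧ a + b = y := by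
  constructor
  · intro h
    obtain ⟨⟨w, hw⟩, hwx, hwy⟩ := (LinearPMap.mem_graph_iff _).1 h
    simp only at hwx hwy
    subst hwx
    exact ⟨f ⟨w, hw.1⟩, g ⟨w, hw.2⟩, f.mem_graph ⟨w, hw.1⟩, g.mem_graph ⟨w, hw.2⟩, hwy⟩
  · rintro ⟨a, b, ha, hb, rfl⟩
    obtain ⟨⟨w, hw⟩, hwx, rfl⟩ := (LinearPMap.mem_graph_iff _).1 ha
    obtain ⟨⟨v, hv⟩, hvx, rfl⟩ := (LinearPMap.mem_graph_iff _).1 hb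
    simp only at hwx hvx
    subst hwx
    subst hvx
    exact (f + g).mem_graph ⟨v, hw, hv⟩

theorem ker_toFun_eq_bot {X Y : Type*} [AddCommGroup X] [Module ℂ X] [AddCommGroup Y] [Module ℂ Y]
    {f : X →ₗ.[ℂ] Y} (hf : Function.Injective f) : LinearMap.ker f.toFun = ⊥ :=
  LinearMap.ker_eq_bot.2 hf

theorem mem_graph_inverse {X Y : Type*} [AddCommGroup X] [Module ℂ X] [AddCommGroup Y] [Module ℂ Y]
    {f : X →ₗ.[ℂ] Y} (hf : Function.Injective f) {x : X} {y : Y} :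
    (y, x) ∈ f.inverse.graph ↔ (x, y) ∈ f.graph := by
  rw [LinearPMap.inverse_graph (ker_toFun_eq_bot hf)]
  simp

variable {E A : H →L[ℂ] H} {ν : ℝ} {k : ℕ}

theorem resolvent_apply_apply {s : ℂ} (hs : s ∈ resolventSet E A) (v : H) :
    resolvent E A s ((s • E + A) v) = v :=
  DFunLike.congr_fun (Ring.inverse_mul_cancel _ hs) v

theorem apply_resolvent_apply {s : ℂ} (hs : s ∈ resolventSet E A) (v : H) :
    (s • E + A) (resolvent E A s v) = v :=
  DFunLike.congr_fun (Ring.mul_inverse_cancel _ hs) v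

variable [CompleteSpace H]

/-- `f = ∂(Eu) + Au` says that `(Eu, f - Au)` lies in the graph of `∂`; the graph form also carries
the domain condition on `u`. -/
theorem mem_graph_daeOp_iff {u f : WeightedL2 H ν} :
    (u, f) ∈ (daeOp E A ν).graph ↔ fourierLaplace H ν f =ᵐ[volume]
      fun x => (linePoint ν x • E + A) (fourierLaplace H ν u x) := by
  have h : (u, f) ∈ (daeOp E A ν).graph ↔
      (E.compLp u, f - A.compLp u) ∈ (timeDeriv H ν).graph := by
    simp only [daeOp, mem_graph_add, mem_graph_opComp, mem_graph_liftOp]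
    constructor
    · rintro ⟨a, b, ⟨y, rfl, hy⟩, rfl, rfl⟩
      rwa [add_sub_cancel_right]
    · intro h
      exact ⟨f - A.compLp u, A.compLp u, ⟨_, rfl, h⟩, rfl, sub_add_cancel _ _⟩
  rw [h, mem_graph_timeDeriv_iff, map_sub]
  refine eventually_congr ?_
  filter_upwards [Lp.coeFn_sub (fourierLaplace H ν f) (fourierLaplace H ν (A.compLp u)),
    fourierLaplace_compLp A u, fourierLaplace_compLp E u] with x h1 h2 h3
  rw [h1, Pi.sub_apply, h2, h3, sub_eq_iff_eq_add]
  rfl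

theorem injective_daeOp (hρ : ∀ x, linePoint ν x ∈ resolventSet E A) :
    Function.Injective (daeOp E A ν) := by
  intro u v huv
  have hu := mem_graph_daeOp_iff.1 ((daeOp E A ν).mem_graph u)
  have hv := mem_graph_daeOp_iff.1 ((daeOp E A ν).mem_graph v)
  refine Subtype.ext (fourierLaplace_ext ?_)
  filter_upwards [hu, hv] with x h1 h2
  rw [huv, h2] at h1
  rw [← resolvent_apply_apply (hρ x) (fourierLaplace H ν (u : WeightedL2 H ν) x), ← h1,
    resolvent_apply_apply (hρ x)]

theorem mem_graph_opPow_inverse (hν : 0 < ν) {f g : WeightedL2 H ν}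
    (h : (f, g) ∈ (opPow (timeDeriv H ν).inverse k).graph) :
    fourierLaplace H ν f =ᵐ[volume] fun x => linePoint ν x ^ k • fourierLaplace H ν g x := by
  induction k generalizing g with
  | zero =>
    obtain ⟨y, hy, rfl⟩ := (LinearPMap.mem_graph_iff _).1 h
    simp only at hy
    rw [← hy]
    refine ae_of_all _ fun x => ?_
    beta_reduce
    rw [pow_zero, one_smul]
    rfl
  | succ k ih =>
    obtain ⟨y, hfy, hyg⟩ := (mem_graph_opComp _ _ _ _).1 h
    rw [mem_graph_inverse (bijective_timeDeriv hν).1, mem_graph_timeDeriv_iff] at hyg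
    filter_upwards [ih hfy, hyg] with x h1 h2
    rw [h1, h2, smul_smul, pow_succ]

theorem exists_mem_graph_opPow_inverse (hν : 0 < ν) (k : ℕ) (f : WeightedL2 H ν) :
    ∃ g, (f, g) ∈ (opPow (timeDeriv H ν).inverse k).graph := by
  induction k with
  | zero => exact ⟨f, (LinearPMap.mem_graph_iff _).2 ⟨⟨f, trivial⟩, rfl, rfl⟩⟩
  | succ k ih =>
    obtain ⟨y, hy⟩ := ih
    obtain ⟨w, rfl⟩ := (bijective_timeDeriv hν).2 y
    refine ⟨w, (mem_graph_opComp _ _ _ _).2 ⟨_, hy, ?_⟩⟩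
    rw [mem_graph_inverse (bijective_timeDeriv hν).1]
    exact LinearPMap.mem_graph _ w

/-- The bounded solution operator: multiplication by `M` on the Fourier–Laplace side. -/
def multiplier (ν : ℝ) (M : Lp (H →L[ℂ] H) ∞ (volume : Measure ℝ)) :
    WeightedL2 H ν →L[ℂ] WeightedL2 H ν :=
  (fourierLaplace H ν).symm.toContinuousLinearEquiv.toContinuousLinearMap ∘L mulOp M ∘L
    (fourierLaplace H ν).toContinuousLinearEquiv.toContinuousLinearMap

theorem fourierLaplace_multiplier (M : Lp (H →L[ℂ] H) ∞ (volume : Measure ℝ))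
    (f : WeightedL2 H ν) :
    fourierLaplace H ν (multiplier ν M f) = mulOp M (fourierLaplace H ν f) :=
  (fourierLaplace H ν).apply_symm_apply _

/-- With hats for transforms and `u` the intermediate value, `f̂ = (sE + A) û` and `û = s^k ŷ`;
applying the symbol to `f̂` leaves `ŷ`. -/
theorem multiplier_eq_of_mem_graph (hν : 0 < ν) (hρ : ∀ x, linePoint ν x ∈ resolventSet E A)
    (hM : MemLp (fun x => symbol E A k (linePoint ν x)) ∞ volume) {f y : WeightedL2 H ν}
    (h : (f, y) ∈ (solOp E A ν k).graph) : multiplier ν hM.toLp f = y := by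
  obtain ⟨u, hfu, huy⟩ := (mem_graph_opComp _ _ _ _).1 h
  rw [mem_graph_inverse (injective_daeOp hρ), mem_graph_daeOp_iff] at hfu
  refine fourierLaplace_ext ?_
  rw [fourierLaplace_multiplier]
  filter_upwards [coeFn_mulOp hM.toLp (fourierLaplace H ν f), hM.coeFn_toLp, hfu,
    mem_graph_opPow_inverse hν huy] with x h1 h2 h3 h4
  rw [h1, h2, symbol, h3, _root_.smul_apply, resolvent_apply_apply (hρ x), h4,
    inv_smul_smul₀ (pow_ne_zero k (linePoint_ne_zero hν x))]

/-- Powers of `∂⁻¹` are everywhere defined, so only membership in the range of `daeOp` matters. -/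
theorem mem_domain_solOp (hν : 0 < ν) (hρ : ∀ x, linePoint ν x ∈ resolventSet E A)
    {u f : WeightedL2 H ν} (h : (u, f) ∈ (daeOp E A ν).graph) :
    f ∈ (solOp E A ν k).domain := by
  obtain ⟨y, hy⟩ := exists_mem_graph_opPow_inverse hν k u
  exact LinearPMap.mem_domain_of_mem_graph ((mem_graph_opComp _ _ _ _).2
    ⟨u, (mem_graph_inverse (injective_daeOp hρ)).2 h, hy⟩)

open scoped SchwartzMap in
-- If `f` has Schwartz transform `h`, the preimage `u` should have transform `(sE + A)⁻¹ h`. The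
-- resolvent may grow like `|s|^k`, but this equals the bounded symbol applied to `s^k h`, which is
-- again Schwartz.
theorem dense_domain_solOp (hν : 0 < ν) (hρ : ∀ x, linePoint ν x ∈ resolventSet E A)
    (hM : MemLp (fun x => symbol E A k (linePoint ν x)) ∞ volume) :
    Dense ((solOp E A ν k).domain : Set (WeightedL2 H ν)) := by
  have hd : DenseRange fun h : 𝓢(ℝ, H) => (fourierLaplace H ν).symm (h.toLp 2 volume) :=
    (fourierLaplace H ν).symm.surjective.denseRange.comp
      (SchwartzMap.denseRange_toLpCLM (by norm_num)) (fourierLaplace H ν).symm.continuous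
  refine hd.mono ?_
  rintro _ ⟨h, rfl⟩
  have hz : (fun x => linePoint ν x ^ k).HasTemperateGrowth := by
    unfold linePoint
    fun_prop
  let g : 𝓢(ℝ, H) := SchwartzMap.smulLeftCLM H (fun x => linePoint ν x ^ k) h
  refine mem_domain_solOp hν hρ
    (u := multiplier ν hM.toLp ((fourierLaplace H ν).symm (g.toLp 2 volume))) ?_
  rw [mem_graph_daeOp_iff, fourierLaplace_multiplier, LinearIsometryEquiv.apply_symm_apply,
    LinearIsometryEquiv.apply_symm_apply]
  filter_upwards [coeFn_mulOp hM.toLp (g.toLp 2 volume), hM.coeFn_toLp, h.coeFn_toLp 2 volume,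
    g.coeFn_toLp 2 volume] with x h1 h2 h3 h4
  rw [h1, h2, h3, h4, symbol, _root_.smul_apply, map_smul,
    apply_resolvent_apply (hρ x), SchwartzMap.smulLeftCLM_apply_apply hz,
    inv_smul_smul₀ (pow_ne_zero k (linePoint_ne_zero hν x))]

end SolutionOperator

/-! ### The contour shift -/

section Contour

variable {V : Type*} [NormedAddCommGroup V] [NormedSpace ℂ V]

/-- A function holomorphic on the closed right half-plane that decays exponentially to the right
and quadratically in the vertical direction has zero integral over the imaginary axis. -/
theorem integral_imaginary_axis_eq_zero [CompleteSpace V] {f : ℂ → V} {K δ : ℝ} (hδ : 0 < δ)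
    (hf : ∀ z : ℂ, 0 ≤ z.re → DifferentiableAt ℂ f z)
    (hb : ∀ z : ℂ, 0 ≤ z.re → ‖f z‖ ≤ K * Real.exp (-δ * z.re) * (1 + z.im ^ 2)⁻¹) :
    ∫ y : ℝ, f (y * Complex.I) = 0 := by
  have hK : 0 ≤ K := by simpa using (norm_nonneg _).trans (hb 0 (by simp))
  have hint : Integrable fun y : ℝ => f (y * Complex.I) := by
    have hcont : Continuous fun y : ℝ => f (y * Complex.I) :=
      continuous_iff_continuousAt.2 fun y => ContinuousAt.comp (f := fun y : ℝ => y * Complex.I)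
        (hf _ (by simp)).continuousAt (by fun_prop)
    refine (integrable_inv_one_add_sq.const_mul K).mono' hcont.aestronglyMeasurable
      (ae_of_all _ fun y => ?_)
    simpa using hb (y * Complex.I) (by simp)
  have hlim : Tendsto (fun n : ℕ => ∫ y : ℝ in (-n : ℝ)..n, f (y * Complex.I)) atTop
      (𝓝 (∫ y : ℝ, f (y * Complex.I))) :=
    intervalIntegral_tendsto_integral hint
      (tendsto_neg_atTop_atBot.comp tendsto_natCast_atTop_atTop) tendsto_natCast_atTop_atTop
  -- Bounds for the other sides of the rectangle `[0, n] × [-n, n]`: two horizontal sides of length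
  -- `n`, controlled by the vertical decay, and the right side of length `2n`, controlled by
  -- `exp(-δn)`.
  have hzero : Tendsto (fun n : ℕ => 2 * (K * ((n : ℝ) * (1 + (n : ℝ) ^ 2)⁻¹))
      + 2 * (K * ((n : ℝ) * Real.exp (-δ * n)))) atTop (𝓝 0) := by
    have h1 : Tendsto (fun n : ℕ => (n : ℝ) * (1 + (n : ℝ) ^ 2)⁻¹) atTop (𝓝 0) := by
      refine squeeze_zero (fun n => by positivity) (fun n => ?_)
        (tendsto_inv_atTop_nhds_zero_nat (𝕜 := ℝ))
      rcases n.eq_zero_or_pos with rfl | hn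
      · simp
      · have : (0 : ℝ) < n := by exact_mod_cast hn
        rw [← div_eq_mul_inv, div_le_iff₀ (by positivity), mul_add, sq,
          inv_mul_cancel_left₀ this.ne']
        exact le_add_of_nonneg_left (by positivity)
    have h2 : Tendsto (fun n : ℕ => (n : ℝ) * Real.exp (-δ * n)) atTop (𝓝 0) := by
      have := (tendsto_rpow_mul_exp_neg_mul_atTop_nhds_zero 1 δ hδ).comp
        (tendsto_natCast_atTop_atTop (R := ℝ))
      simpa [Function.comp_def] using this
    simpa using ((h1.const_mul K).const_mul 2).add ((h2.const_mul K).const_mul 2)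
  refine tendsto_nhds_unique hlim (squeeze_zero_norm (fun n => ?_) hzero)
  have hrect := Complex.integral_boundary_rect_eq_zero_of_differentiableOn f
    ((0 : ℝ) + (-n : ℝ) * Complex.I) ((n : ℝ) + (n : ℝ) * Complex.I) (fun z hz => by
      refine (hf z ?_).differentiableWithinAt
      have := (Complex.mem_reProdIm.1 hz).1
      simp at this
      exact this.1)
  simp only [Complex.add_re, Complex.add_im, Complex.ofReal_re, Complex.ofReal_im, Complex.mul_re,
    Complex.mul_im, Complex.I_re, Complex.I_im, mul_zero, mul_one, sub_zero, add_zero,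
    zero_add] at hrect
  simp only [Complex.ofReal_zero, zero_add, sub_eq_zero] at hrect
  have hhor : ∀ c : ℝ, c ^ 2 = (n : ℝ) ^ 2 → ‖∫ x : ℝ in (0 : ℝ)..n, f (x + c * Complex.I)‖
      ≤ K * ((n : ℝ) * (1 + (n : ℝ) ^ 2)⁻¹) := by
    intro c hc
    refine (intervalIntegral.norm_integral_le_of_norm_le_const
      (C := K * (1 + (n : ℝ) ^ 2)⁻¹) fun x hx => ?_).trans_eq ?_
    · rw [uIoc_of_le (by positivity)] at hx
      refine (hb _ (by simpa using hx.1.le)).trans ?_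
      simp only [Complex.add_re, Complex.add_im, Complex.ofReal_re, Complex.ofReal_im,
        Complex.mul_re, Complex.mul_im, Complex.I_re, Complex.I_im, mul_zero, mul_one, sub_zero,
        add_zero, zero_add, hc]
      refine mul_le_mul_of_nonneg_right (mul_le_of_le_one_right hK ?_) (by positivity)
      rw [Real.exp_le_one_iff]
      nlinarith [hx.1]
    · rw [sub_zero, abs_of_nonneg (by positivity)]
      ring
  have hver : ‖∫ y : ℝ in (-n : ℝ)..n, f ((n : ℝ) + y * Complex.I)‖
      ≤ 2 * (K * ((n : ℝ) * Real.exp (-δ * n))) := by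
    refine (intervalIntegral.norm_integral_le_of_norm_le_const
      (C := K * Real.exp (-δ * n)) fun y _ => ?_).trans_eq ?_
    · refine (hb _ (by simp)).trans ?_
      simp only [Complex.add_re, Complex.add_im, Complex.ofReal_re, Complex.ofReal_im,
        Complex.mul_re, Complex.mul_im, Complex.I_re, Complex.I_im, mul_zero, mul_one, sub_zero,
        add_zero, zero_add]
      refine mul_le_of_le_one_right (by positivity) (inv_le_one_of_one_le₀ ?_)
      nlinarith [sq_nonneg y]
    · rw [sub_neg_eq_add, abs_of_nonneg (by positivity)]
      ring
  have hbot := hhor (-n) (by ring)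
  have htop := hhor n rfl
  have hleft : ‖∫ y : ℝ in (-n : ℝ)..n, f (y * Complex.I)‖
      = ‖Complex.I • ∫ y : ℝ in (-n : ℝ)..n, f (y * Complex.I)‖ := by
    rw [norm_smul, Complex.norm_I, one_mul]
  rw [hleft, ← hrect]
  refine (norm_add_le _ _).trans (add_le_add ((norm_sub_le _ _).trans ?_) ?_)
  · linarith
  · rwa [norm_smul, Complex.norm_I, one_mul]

end Contour

/-! ### Two-sided Laplace transforms of compactly supported functions -/

section Laplace

variable {V : Type*} [NormedAddCommGroup V] [NormedSpace ℂ V]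

/-- The two-sided Laplace transform `w ↦ ∫ exp(-2πwt) h(t) dt`. -/
def laplace (h : ℝ → V) (w : ℂ) : V := ∫ t : ℝ, Complex.exp (-2 * Real.pi * w * t) • h t

theorem continuous_exp_smul {h : ℝ → V} (hh : Continuous h) (w : ℂ) :
    Continuous fun t : ℝ => Complex.exp (-2 * Real.pi * w * t) • h t := by
  fun_prop

theorem integrable_exp_smul {h : ℝ → V} (hh : Continuous h) (hc : HasCompactSupport h) (w : ℂ) :
    Integrable fun t : ℝ => Complex.exp (-2 * Real.pi * w * t) • h t :=
  (continuous_exp_smul hh w).integrable_of_hasCompactSupport hc.smul_left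

theorem norm_exp_eq (w : ℂ) (t : ℝ) :
    ‖Complex.exp (-2 * Real.pi * w * t)‖ = Real.exp (-2 * Real.pi * (w.re * t)) := by
  rw [Complex.norm_exp]
  congr 1
  simp
  ring

/-- Differentiation under the integral: on the unit ball around `w` the compact support of `h`
supplies an integrable majorant. -/
theorem differentiable_laplace {h : ℝ → V} (hh : Continuous h) (hc : HasCompactSupport h) :
    Differentiable ℂ (laplace h) := by
  intro w
  have hm : ∀ w : ℂ, Continuous fun t : ℝ =>
      ((-2 * Real.pi * t) * Complex.exp (-2 * Real.pi * w * t)) • h t := fun w => by fun_prop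
  have hb : Continuous fun t : ℝ =>
      (2 * Real.pi * |t| * Real.exp (2 * Real.pi * ((‖w‖ + 1) * |t|))) * ‖h t‖ := by fun_prop
  refine (hasDerivAt_integral_of_dominated_loc_of_deriv_le
    (F' := fun w t => ((-2 * Real.pi * t) * Complex.exp (-2 * Real.pi * w * t)) • h t)
    (Metric.ball_mem_nhds w one_pos)
    (Eventually.of_forall fun w => (continuous_exp_smul hh w).aestronglyMeasurable)
    (integrable_exp_smul hh hc w) (hm w).aestronglyMeasurable (ae_of_all _ fun t z hz => ?_)
    (hb.integrable_of_hasCompactSupport hc.norm.mul_left)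
    (ae_of_all _ fun t z _ => ?_)).2.differentiableAt
  · rw [norm_smul, norm_mul, norm_exp_eq]
    have h1 : ‖(-2 * Real.pi * t : ℂ)‖ = 2 * Real.pi * |t| := by
      simp [abs_of_pos Real.pi_pos]
    rw [h1]
    refine mul_le_mul_of_nonneg_right
      (mul_le_mul_of_nonneg_left (Real.exp_le_exp.2 ?_) (by positivity)) (norm_nonneg _)
    have h2 : ‖z‖ ≤ ‖w‖ + 1 := by
      have := norm_sub_norm_le z w
      have := mem_ball_iff_norm.1 hz
      linarith
    have h3 : -(z.re * t) ≤ (‖w‖ + 1) * |t| := by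
      refine (neg_le_abs _).trans ?_
      rw [abs_mul]
      gcongr
      exact (Complex.abs_re_le_norm z).trans h2
    nlinarith [Real.pi_pos]
  · have h0 : HasDerivAt (fun z : ℂ => -2 * Real.pi * z * t) (-2 * Real.pi * t) z := by
      simpa using ((hasDerivAt_id z).const_mul (-2 * Real.pi : ℂ)).mul_const (t : ℂ)
    have := h0.cexp.smul_const (h t)
    rwa [mul_comm (Complex.exp _)] at this

/-- The free constant `c` covers both later uses: support in `[a, ∞)` at `w`, and support in `(-∞,
b]` at `-w`, for `Re w ≥ 0`. -/
theorem norm_laplace_le {h : ℝ → V} (hh : Continuous h) (hc : HasCompactSupport h) {w : ℂ} {c : ℝ}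
    (hw : ∀ t ∈ tsupport h, c ≤ w.re * t) :
    ‖laplace h w‖ ≤ Real.exp (-2 * Real.pi * c) * ∫ t, ‖h t‖ := by
  rw [← integral_const_mul]
  refine norm_integral_le_of_norm_le
    ((hh.integrable_of_hasCompactSupport hc).norm.const_mul _) (ae_of_all _ fun t => ?_)
  rw [norm_smul, norm_exp_eq]
  by_cases ht : t ∈ tsupport h
  · gcongr ?_ * _
    rw [Real.exp_le_exp]
    nlinarith [hw t ht, Real.pi_pos]
  · simp [image_eq_zero_of_notMem_tsupport ht]

theorem laplace_deriv {h : ℝ → V} (hh : ContDiff ℝ ∞ h) (hc : HasCompactSupport h) (w : ℂ) :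
    laplace (deriv h) w = (2 * Real.pi * w) • laplace h w := by
  have hd : ∀ t : ℝ, HasDerivAt (fun t : ℝ => Complex.exp (-2 * Real.pi * w * t) • h t)
      (Complex.exp (-2 * Real.pi * w * t) • deriv h t
        + (Complex.exp (-2 * Real.pi * w * t) * (-2 * Real.pi * w)) • h t) t := by
    intro t
    have h0 : HasDerivAt (fun t : ℝ => -2 * Real.pi * w * (t : ℂ)) (-2 * Real.pi * w) t := by
      simpa using (Complex.ofRealCLM.hasDerivAt (x := t)).const_mul (-2 * Real.pi * w)
    exact h0.cexp.smul (hh.differentiable (by simp) t).hasDerivAt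
  have i1 := integrable_exp_smul (hh.continuous_deriv (by simp)) hc.deriv w
  have i2 := integrable_exp_smul hh.continuous hc w
  have e2 : ∀ t : ℝ, (Complex.exp (-2 * Real.pi * w * t) * (-2 * Real.pi * w)) • h t
      = (-2 * Real.pi * w) • Complex.exp (-2 * Real.pi * w * t) • h t := fun t => by
    rw [smul_smul, mul_comm]
  simp only [e2] at hd
  have := integral_eq_zero_of_hasDerivAt_of_integrable hd (i1.add (i2.smul _)) i2
  have e3 := integral_add i1 (i2.smul (-2 * Real.pi * w : ℂ))
  simp only [Pi.smul_apply, integral_smul] at e3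
  rw [e3] at this
  rw [laplace, laplace, eq_neg_of_add_eq_zero_left this, ← neg_smul]
  congr 1
  ring

/-- Two integrations by parts give the factor `(2πw)²`, hence the quadratic decay in `Im w` that the
contour shift requires. -/
theorem exists_norm_laplace_le {h : ℝ → V} (hh : ContDiff ℝ ∞ h) (hc : HasCompactSupport h) {a : ℝ}
    (ha : tsupport h ⊆ Ici a) : ∃ K : ℝ, ∀ w : ℂ, 0 ≤ w.re →
      ‖laplace h w‖ ≤ Real.exp (-2 * Real.pi * (w.re * a)) * K * (1 + w.im ^ 2)⁻¹ := by
  have hh' : ContDiff ℝ ∞ (deriv h) := by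
    exact (contDiff_infty_iff_deriv.1 hh).2
  have ht : tsupport (deriv (deriv h)) ⊆ tsupport h :=
    (tsupport_deriv_subset).trans tsupport_deriv_subset
  refine ⟨(∫ t, ‖h t‖) + ∫ t, ‖deriv (deriv h) t‖, fun w hw => ?_⟩
  have h1 := norm_laplace_le hh.continuous hc (w := w) (c := w.re * a) fun t ht =>
    mul_le_mul_of_nonneg_left (ha ht) hw
  have h2 := norm_laplace_le (hh'.continuous_deriv (by simp)) hc.deriv.deriv (w := w)
    (c := w.re * a) fun t h't => mul_le_mul_of_nonneg_left (ha (ht h't)) hw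
  rw [laplace_deriv hh' hc.deriv, laplace_deriv hh hc, norm_smul, norm_smul, ← mul_assoc] at h2
  rw [← div_eq_mul_inv, le_div_iff₀ (by positivity), mul_add, mul_add, mul_one]
  refine add_le_add h1 (le_trans ?_ h2)
  rw [mul_comm]
  refine mul_le_mul_of_nonneg_right ?_ (norm_nonneg _)
  have h3 : |w.im| ≤ ‖(2 * Real.pi * w : ℂ)‖ := by
    refine (Complex.abs_im_le_norm w).trans ?_
    rw [norm_mul]
    refine le_mul_of_one_le_left (norm_nonneg _) ?_
    simp only [norm_mul, Complex.norm_ofNat, Complex.norm_real, Real.norm_of_nonneg Real.pi_pos.le]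
    nlinarith [Real.pi_gt_three]
  rw [← sq_abs, sq]
  exact mul_self_le_mul_self (abs_nonneg _) h3

open scoped FourierTransform

theorem fourier_eq_laplace (h : ℝ → V) (x : ℝ) : 𝓕 h x = laplace h (x * Complex.I) := by
  rw [Real.fourier_eq', laplace]
  refine integral_congr_ae (ae_of_all _ fun t => ?_)
  beta_reduce
  congr 2
  simp
  ring

theorem fourierInv_eq_laplace (h : ℝ → V) (x : ℝ) :
    𝓕⁻ h x = laplace h (-(x * Complex.I)) := by
  rw [Real.fourierInv_eq', laplace]
  refine integral_congr_ae (ae_of_all _ fun t => ?_)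
  beta_reduce
  congr 2
  simp
  ring

end Laplace

/-! ### Essential support and half-lines -/

section Support

theorem essSupp_subset_Ici_iff {H : Type*} [NormedAddCommGroup H] {f : ℝ → H} {a : ℝ} :
    essSupp f ⊆ Ici a ↔ ∀ᵐ t, t ∈ Iio a → f t = 0 := by
  constructor
  · intro h
    -- Vanishing near each point of `Iio a` gives vanishing almost everywhere, because locally null
    -- sets are null.
    refine measure_null_of_locally_null _ fun t ht => ?_
    have hta : t < a := by
      by_contra hta
      exact ht fun h => absurd h hta
    have htf : t ∉ essSupp f := fun h' => absurd (h h') (not_le.2 hta)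
    simp only [essSupp, mem_ofPred_eq, not_forall, not_not] at htf
    obtain ⟨U, hU, hfU⟩ := htf
    obtain ⟨W, hWU, hW, htW⟩ := mem_nhds_iff.1 hU
    have hfW := (ae_restrict_iff' hW.measurableSet).1
      (ae_restrict_of_ae_restrict_of_subset hWU hfU)
    refine ⟨_, inter_mem self_mem_nhdsWithin (mem_nhdsWithin_of_mem_nhds (hW.mem_nhds htW)),
      measure_mono_null (fun x hx => ?_) hfW⟩
    exact fun h => hx.1 fun _ => h hx.2
  · intro h t ht
    by_contra hta
    refine ht (Iio a) (Iio_mem_nhds (not_le.1 hta)) ?_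
    exact (ae_restrict_iff' measurableSet_Iio).2 h

end Support

/-! ### Density of smooth compactly supported functions -/

section Density

open scoped SchwartzMap

variable {H : Type*} [NormedAddCommGroup H] [InnerProductSpace ℂ H]

theorem dense_smooth_compactSupport : Dense {F : Lp H 2 (volume : Measure ℝ) |
    ∃ (h : ℝ → H) (hc : HasCompactSupport h) (hh : ContDiff ℝ ∞ h),
      F = (hc.toSchwartzMap hh).toLp 2 volume} := by
  intro F
  refine (mem_closure_iff_nhds_basis Metric.nhds_basis_closedBall).2 fun ε hε => ?_
  obtain ⟨g, hg₁, hg₂, hg₃⟩ := MemLp.exist_eLpNorm_sub_le (p := 2) (by norm_num) (by norm_num)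
    (Lp.memLp F) hε
  refine ⟨_, ⟨g, hg₁, hg₂, rfl⟩, ?_⟩
  have : (F : ℝ → H) - ((hg₁.toSchwartzMap hg₂).toLp 2 volume : ℝ → H) =ᵐ[volume]
      (F : ℝ → H) - g := by
    filter_upwards [(hg₁.toSchwartzMap hg₂).coeFn_toLp 2 volume] with x hx
    rw [Pi.sub_apply, hx]
    rfl
  rw [Metric.mem_closedBall', Lp.dist_def, eLpNorm_congr_ae this]
  exact ENNReal.toReal_le_of_le_ofReal hε.le hg₃

end Density

/-! ### Causality of the multiplier -/

section Causality

open scoped SchwartzMap FourierTransform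

variable {H : Type*} [NormedAddCommGroup H] [InnerProductSpace ℂ H] [CompleteSpace H]
  {E A : H →L[ℂ] H} {ν C : ℝ} {k : ℕ}

/-- Contour shift for the product of the symbol with the transforms of a test function supported
on `(-∞, b]` and of a function supported on `[a, ∞)`, where `b < a`. -/
theorem integral_laplace_symbol_eq_zero (hν : 0 < ν)
    (hρ : {s : ℂ | ν < s.re} ⊆ resolventSet E A) (hC : 0 ≤ C) (hb : ResolventBound E A ν C k)
    {a b : ℝ} (hab : b < a) {h : ℝ → H} (hh : ContDiff ℝ ∞ h) (hc : HasCompactSupport h)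
    (hs : tsupport h ⊆ Ici a) {ψ : ℝ → ℂ} (hψ : Continuous ψ) (hψc : HasCompactSupport ψ)
    (hψs : tsupport ψ ⊆ Iic b) :
    ∫ y : ℝ, laplace ψ (-(y * Complex.I)) •
      symbol E A k (linePoint ν y) (laplace h (y * Complex.I)) = 0 := by
  obtain ⟨K, hK⟩ := exists_norm_laplace_le hh hc hs
  have hre : ∀ w : ℂ, 0 ≤ w.re → ν ≤ (ν + 2 * Real.pi * w).re := fun w hw => by
    have : (0 : ℝ) ≤ 2 * Real.pi * w.re := by positivity
    simpa using this
  -- The transform of `ψ` at `-w` grows at most like `exp(2πb Re w)`, that of `h` at `w` decays like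
  -- `exp(-2πa Re w)`, and the symbol contributes at most `C`.
  have key := integral_imaginary_axis_eq_zero (δ := 2 * Real.pi * (a - b))
    (K := (∫ t, ‖ψ t‖) * (C * K))
    (f := fun w => laplace ψ (-w) • symbol E A k (ν + 2 * Real.pi * w) (laplace h w))
    (by have := sub_pos.2 hab; positivity) (fun w hw => ?_) (fun w hw => ?_)
  · refine (integral_congr_ae (ae_of_all _ fun y => ?_)).trans key
    have : linePoint ν y = ν + 2 * Real.pi * (y * Complex.I) := by
      rw [linePoint]
      ring
    simp only [this]
  · have h1 : DifferentiableAt ℂ (fun w : ℂ => symbol E A k (ν + 2 * Real.pi * w)) w :=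
      DifferentiableAt.comp (g := symbol E A k) w
        (differentiableAt_symbol hν hρ hC hb (hre w hw)) (by fun_prop)
    have h2 : DifferentiableAt ℂ (fun w : ℂ => laplace ψ (-w)) w :=
      DifferentiableAt.comp (g := laplace ψ) w (differentiable_laplace hψ hψc _) (by fun_prop)
    exact h2.smul (h1.clm_apply (differentiable_laplace hh.continuous hc w))
  · have e1 := norm_laplace_le hψ hψc (w := -w) (c := -(w.re * b)) fun t ht => by
      rw [Complex.neg_re, neg_mul, neg_le_neg_iff]
      exact mul_le_mul_of_nonneg_left (hψs ht) hw
    have e2 := (ContinuousLinearMap.le_opNorm (symbol E A k (ν + 2 * Real.pi * w))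
      (laplace h w)).trans (mul_le_mul (norm_symbol_le hν hρ hC hb (hre w hw)) (hK w hw)
        (norm_nonneg _) hC)
    rw [norm_smul]
    refine (mul_le_mul e1 e2 (norm_nonneg _) (by positivity)).trans_eq ?_
    have : Real.exp (-(2 * Real.pi * (a - b)) * w.re)
        = Real.exp (-2 * Real.pi * -(w.re * b)) * Real.exp (-2 * Real.pi * (w.re * a)) := by
      rw [← Real.exp_add]
      ring_nf
    rw [this]
    ring

/-- The pairing with a test function is bilinear, so duality puts `𝓕⁻` on the test function. This
extends holomorphically as `laplace ψ (-w)`, and no complex conjugate appears. -/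
theorem multiplier_symbol_ae_eq_zero_of_smooth (hν : 0 < ν)
    (hρ : {s : ℂ | ν < s.re} ⊆ resolventSet E A) (hC : 0 ≤ C) (hb : ResolventBound E A ν C k)
    (hM : MemLp (fun x => symbol E A k (linePoint ν x)) ∞ volume)
    {a b : ℝ} (hab : b < a) {h : ℝ → H} (hh : ContDiff ℝ ∞ h) (hc : HasCompactSupport h)
    (hs : tsupport h ⊆ Ici a) {f : WeightedL2 H ν}
    (hf : weightEquiv H ν f = (hc.toSchwartzMap hh).toLp 2 volume) :
    ∀ᵐ t, t ∈ Iio b → weightEquiv H ν (multiplier ν hM.toLp f) t = 0 := by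
  refine isOpen_Iio.ae_eq_zero_of_integral_contDiff_smul_eq_zero
    (((Lp.memLp _).locallyIntegrable (by norm_num)).locallyIntegrableOn _) fun φ hφ hφc hφs => ?_
  have e := integral_smul_eq_fourierInv_smul_fourier
    (weightEquiv H ν (multiplier ν hM.toLp f)) (testFunction hφ hφc)
  simp only [testFunction_apply, Complex.coe_smul] at e
  rw [e, ← fourierLaplace_apply, fourierLaplace_multiplier, fourierLaplace_apply, hf,
    SchwartzMap.toLp_fourier_eq]
  have hψc : HasCompactSupport fun t => (φ t : ℂ) := hφc.comp_left (g := Complex.ofReal) (by simp)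
  have hψs : tsupport (fun t => (φ t : ℂ)) ⊆ Iic b :=
    (closure_mono (Function.support_comp_subset (g := Complex.ofReal) (by simp) φ)).trans
      (hφs.trans Iio_subset_Iic_self)
  rw [← integral_laplace_symbol_eq_zero hν hρ hC hb hab hh hc hs
    (Complex.continuous_ofReal.comp hφ.continuous) hψc hψs]
  refine integral_congr_ae ?_
  filter_upwards [coeFn_mulOp hM.toLp ((𝓕 (hc.toSchwartzMap hh)).toLp 2 volume), hM.coeFn_toLp,
    (𝓕 (hc.toSchwartzMap hh)).coeFn_toLp 2 volume] with x h1 h2 h3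
  rw [h1, h2, h3, SchwartzMap.fourierInv_coe, fourierInv_eq_laplace, SchwartzMap.fourier_coe,
    fourier_eq_laplace]
  rfl

/-- Smooth approximants of `exp(-ν·) f` need not vanish on the left, so they are multiplied by a
cutoff `χ` which leaves `exp(-ν·) f` itself unchanged. The smooth case makes the continuous map `T`
vanish on a dense set, hence everywhere. -/
theorem multiplier_symbol_ae_eq_zero (hν : 0 < ν)
    (hρ : {s : ℂ | ν < s.re} ⊆ resolventSet E A) (hC : 0 ≤ C) (hb : ResolventBound E A ν C k)
    (hM : MemLp (fun x => symbol E A k (linePoint ν x)) ∞ volume)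
    {a b : ℝ} (hab : b < a) {f : WeightedL2 H ν} (hf : ∀ᵐ t, t ∈ Iio a → f t = 0) :
    ∀ᵐ t, t ∈ Iio b → multiplier ν hM.toLp f t = 0 := by
  obtain ⟨c, hbc, hca⟩ := exists_between hab
  -- Zero on `(-∞, c]` and one on `[a, ∞)`; the remaining gap `b < c` is spent on the contour shift.
  let χ : ℝ → ℝ := fun t => Real.smoothTransition ((t - c) / (a - c))
  have hχ : ContDiff ℝ ∞ χ := Real.smoothTransition.contDiff.comp (by fun_prop)
  have hX : MemLp (fun t => χ t • ContinuousLinearMap.id ℂ H) ∞ volume := by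
    refine memLp_top_of_continuous (C := ‖ContinuousLinearMap.id ℂ H‖)
      (hχ.continuous.smul continuous_const) fun t => ?_
    rw [norm_smul, Real.norm_of_nonneg (Real.smoothTransition.nonneg _)]
    exact mul_le_of_le_one_left (norm_nonneg _) (Real.smoothTransition.le_one _)
  let R := LpToLpRestrictCLM ℝ H ℂ (volume : Measure ℝ) 2 (Iio b)
  let T : Lp H 2 (volume : Measure ℝ) → Lp H 2 ((volume : Measure ℝ).restrict (Iio b)) := fun F =>
    R (weightEquiv H ν (multiplier ν hM.toLp ((weightEquiv H ν).symm (mulOp hX.toLp F))))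
  have hT : Continuous T := R.continuous.comp ((weightEquiv H ν).continuous.comp
    ((multiplier ν hM.toLp).continuous.comp ((weightEquiv H ν).symm.continuous.comp
      (mulOp hX.toLp).continuous)))
  have hR : ∀ G, R G = 0 ↔ ∀ᵐ t, t ∈ Iio b → G t = 0 := fun G => by
    rw [Lp.eq_zero_iff_ae_eq_zero, ← ae_restrict_iff' measurableSet_Iio]
    refine eventually_congr ?_
    filter_upwards [LpToLpRestrictCLM_coeFn ℂ (Iio b) G] with t ht
    rw [ht]
    rfl
  have hT0 : T = fun _ => 0 := by
    refine hT.ext_on dense_smooth_compactSupport continuous_const ?_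
    rintro _ ⟨h, hc, hh, rfl⟩
    have hc' : HasCompactSupport fun t => χ t • h t := hc.smul_left
    have hh' : ContDiff ℝ ∞ fun t => χ t • h t := hχ.smul hh
    refine (hR _).2 (multiplier_symbol_ae_eq_zero_of_smooth hν hρ hC hb hM hbc hh' hc' ?_ ?_)
    · refine closure_minimal (fun t ht => ?_) isClosed_Ici
      by_contra htc
      refine ht (smul_eq_zero_of_left (Real.smoothTransition.zero_of_nonpos ?_) _)
      exact div_nonpos_of_nonpos_of_nonneg (sub_nonpos.2 (not_le.1 htc).le) (sub_pos.2 hca).le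
    · rw [LinearIsometryEquiv.apply_symm_apply]
      refine Lp.ext ?_
      filter_upwards [coeFn_mulOp hX.toLp ((hc.toSchwartzMap hh).toLp 2 volume), hX.coeFn_toLp,
        (hc.toSchwartzMap hh).coeFn_toLp 2 volume,
        (hc'.toSchwartzMap hh').coeFn_toLp 2 volume] with t h1 h2 h3 h4
      rw [h1, h2, h3, h4]
      rfl
  rw [← weightEquiv_ae_eq_zero_iff, ← hR, ← congrFun hT0 (weightEquiv H ν f)]
  have hXf : mulOp hX.toLp (weightEquiv H ν f) = weightEquiv H ν f := by
    refine Lp.ext ?_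
    filter_upwards [coeFn_mulOp hX.toLp (weightEquiv H ν f), hX.coeFn_toLp,
      (weightEquiv_ae_eq_zero_iff f (Iio a)).2 hf] with t h1 h2 h3
    rw [h1, h2]
    by_cases hta : t < a
    · rw [h3 hta, map_zero]
    · have : χ t = 1 := Real.smoothTransition.one_of_one_le
        ((one_le_div (sub_pos.2 hca)).2 (sub_le_sub_right (not_lt.1 hta) c))
      rw [this, one_smul]
      rfl
  simp only [T, hXf, LinearIsometryEquiv.symm_apply_apply]

end Causality

end DAE

end


theorem corollary2p2 {H : Type*} [NormedAddCommGroup H] [InnerProductSpace ℂ H] [CompleteSpace H]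
    (E A : H →L[ℂ] H)
    (ν₀ : ℝ) (hreg : DAE.IsRegularOn E A ν₀)
    (ν : ℝ) (hν : 0 < ν)
    (hρ : {s : ℂ | ν < s.re} ⊆ DAE.resolventSet E A)
    (C : ℝ) (hC : 0 ≤ C) (hbound : DAE.ResolventBound E A ν C (DAE.index E A ν₀)) :
    -- the inverses are meaningful
    Function.Bijective (DAE.timeDeriv H ν) ∧
    Function.Injective (DAE.daeOp E A ν) ∧
    -- the operator is densely defined
    Dense ((DAE.solOp E A ν (DAE.index E A ν₀)).domain : Set (DAE.WeightedL2 H ν)) ∧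
    -- it extends (uniquely) to a bounded operator on the whole space, and this is causal
    ∃ S : DAE.WeightedL2 H ν →L[ℂ] DAE.WeightedL2 H ν,
      (∀ f : (DAE.solOp E A ν (DAE.index E A ν₀)).domain,
        S f = DAE.solOp E A ν (DAE.index E A ν₀) f) ∧
      ∀ (a : ℝ) (f : DAE.WeightedL2 H ν),
        DAE.essSupp (f : ℝ → H) ⊆ Set.Ici a → DAE.essSupp (S f : ℝ → H) ⊆ Set.Ici a := by
  have hline : ∀ x, DAE.linePoint ν x ∈ DAE.resolventSet E A := fun x =>
    DAE.mem_resolventSet_of_le hρ hC hbound (DAE.linePoint_re ν x).ge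
  have hM := DAE.memLp_symbol hν hρ hC hbound
  refine ⟨DAE.bijective_timeDeriv hν, DAE.injective_daeOp hline,
    DAE.dense_domain_solOp hν hline hM, DAE.multiplier ν hM.toLp, fun f =>
      DAE.multiplier_eq_of_mem_graph hν hline hM (LinearPMap.mem_graph _ f), fun a f hf => ?_⟩
  intro t ht
  by_contra hta
  -- The contour shift needs a strict gap below `a`; a support point `t < a` leaves room for `b` in
  -- between.
  obtain ⟨b, htb, hba⟩ := exists_between (not_le.1 (mt mem_Ici.2 hta))
  have h := DAE.multiplier_symbol_ae_eq_zero hν hρ hC hbound hM hba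
    (DAE.essSupp_subset_Ici_iff.1 hf)
  exact absurd (DAE.essSupp_subset_Ici_iff.2 h ht) (not_le.2 htb)
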